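/- **Setting.** Let $\mathcal C$ be a class of measurable concepts $X\to\{0,1\}$ of finite VC dimension $d$, universally separable (some countable subclass is sequentially dense for pointwise convergence). A crowd consists of $n\ge 1$ workers $w_1,\dots,w_n$ with noise rates $\eta_i\in[0,1/2]$; let $\bar\eta_W=\frac1n\sum_i\eta_i$ and $\eta^*_{1,W}=\min_i\eta_i$, and assume $\bar\eta_W<1/2$. Data points are drawn independently from an unknown distribution $D$ on $X$, and there is an unknown target $c\in\mathcal C$. Worker $w_i$ mislabels a drawn data point with probability $\eta_i$, independently over workers and over drawn data points; the noise is persistent, i.e. a worker asked again about the same drawn data point repeats the label. Every label requested from a worker is one task. Put $\Delta=(1/2-\eta^*_{1,W})/2$; a worker $w_i$ is $\Delta$-optimal if $\eta_i\le\eta^*_{1,W}+\Delta$. **Algorithm** (with parameters $T,L,m$). *Step 1:* draw $T$ data points and label each by the majority vote of $L$ distinct workers chosen uniformly at random (independently for each point). *Step 2:* let every worker label all $T$ points, and pick a worker $\hat w$ who agrees most often with the majority labels. *Step 3:* draw $m$ further data points, let $\hat w$ label them, and return a hypothesis $h\in\mathcal C$ with the fewest disagreements with these labels, supplied by an empirical-risk-minimization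 oracle for $\mathcal C$. **Theorem 5.** For every $\delta_0<1$ there are constants $A,C>0$ and $k\in\mathbb N$, depending only on $\delta_0$, such that the following holds for all $n$, $d$, $\eta_1,\dots,\eta_n$ as above, all $\varepsilon>0$ and all $0<\delta\le\delta_0$. Let $$T=\left\lceil \frac{A\log(n/\delta)}{\Delta^2}\right\rceil,\qquad L=\left\lceil\frac{A\log(T/\delta)}{(1-2\bar\eta_W)^2}\right\rceil,$$ and suppose that the crowd is large enough for the votes, i.e. $L\le n$. Then there is an $m$, depending only on $n,d,\eta_1,\dots,\eta_n,\varepsilon,\delta$, such that for every class $\mathcal C$ of VC dimension $d$, every empirical risk minimizer for it, every target $c\in\mathcal C$ and every distribution $D$: 1. the algorithm always uses at most $$C\left(\frac{\log^2(n/\delta)}{(1-2\eta^*_{1,W})^2(1-2\bar\eta_W)^2}+\frac{\left(n+\frac d\varepsilon\right)\log(1/\delta)}{(1-2\eta^*_{1,W})^2}\right)\cdot\log^k\!\left(2+n+\frac1\varepsilon+\frac1{1-2\eta^*_{1,W}}\right)$$ tasks, and at most that many elementary steps (label queries, counter updates, comparisons, and handing the $m$ labelled examples to the oracle); 2. with probability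 at least $1-\delta$, the worker $\hat w$ is $\Delta$-optimal and $\Pr_{x\sim D}[h(x)\ne c(x)]<\varepsilon$. That is, $\tilde O\left(\frac{\log^2(n/\delta)}{(1-2\eta^*_{1,W})^2(1-2\bar\eta_W)^2}+\frac{(n+d/\varepsilon)\log(1/\delta)}{(1-2\eta^*_{1,W})^2}\right)$ tasks suffice to PAC-learn $\mathcal C$ efficiently, given an empirical risk minimizer. -/

import Mathlib

open MeasureTheory ProbabilityTheory Filter

/-! ### Instrumented computations -/

/-- A computation that returns `val`, has used `tasks` worker-labelled tasks (one for every label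
requested from a worker), and has taken `steps` elementary steps. -/
structure Run (α : Type*) where
  val : α
  tasks : ℕ
  steps : ℕ

namespace Run

/-- Return a value at no cost. -/
def pure {α : Type*} (a : α) : Run α := ⟨a, 0, 0⟩

/-- Return a value at the cost of one elementary step. -/
def step {α : Type*} (a : α) : Run α := ⟨a, 0, 1⟩

/-- Run `r`, then run `f` on its result; the costs add up. -/
def bind {α β : Type*} (r : Run α) (f : α → Run β) : Run β :=
  ⟨(f r.val).val, r.tasks + (f r.val).tasks, r.steps + (f r.val).steps⟩

/-- Run `f` on all members of a list, in order, and collect the results. -/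
def forAll {α β : Type*} (f : α → Run β) : List α → Run (List β)
  | [] => pure []
  | a :: l => (f a).bind fun b => (forAll f l).bind fun bs => pure (b :: bs)

/-- The number of members of a list on which `q` answers `true`; one step per member for the
counter. -/
def tally {α : Type*} (q : α → Run Bool) : List α → Run ℕ
  | [] => pure 0
  | a :: l => (q a).bind fun b => (tally q l).bind fun k => step (if b then k + 1 else k)

/-- Scan a list for a member with the largest score, starting from the current champion `best`
(a candidate with its score); one step per comparison. -/
def argmax {α : Type*} (score : α → Run ℕ) : α × ℕ → List α → Run α
  | best, [] => pure best.1
  | best, a :: l => (score a).bind fun s =>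
      (step (if best.2 < s then (a, s) else best)).bind fun best' => argmax score best' l

end Run

/-! ### The three-step algorithm

The algorithm sees abstract data points `ι`.  It can ask a worker to label a data point (`ask`),
and it can read the unlabelled instance that belongs to a data point (`point`); it has no other
access to the target concept or to the noise. -/

section Algorithm

variable {ι X : Type*} {n T L m : ℕ}

/-- Step 1: the data point `g t` is labelled by the workers `v t 0, …, v t (L - 1)`, and the strict
majority of `true` votes decides its label. -/
def groundTruth (ask : ι → Fin n → Run Bool) (g : Fin T → ι) (v : Fin T → Fin L → Fin n) :
    Run (List (ι × Bool)) :=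
  Run.forAll (fun t => (Run.tally (fun j => ask (g t) (v t j)) (List.finRange L)).bind fun k =>
    Run.step (g t, decide (L < 2 * k))) (List.finRange T)

/-- Step 2: every worker labels all ground-truth points, and a worker who agrees with the
ground-truth labels most often is returned. -/
def bestWorker [NeZero n] (ask : ι → Fin n → Run Bool) (G : List (ι × Bool)) : Run (Fin n) :=
  Run.argmax (fun w => Run.tally (fun z => (ask z.1 w).bind fun b => Run.step (b == z.2)) G)
    (0, 0) (List.finRange n)

/-- Step 3: worker `w` labels the data points `s 0, …, s (m - 1)`, and the labelled sample is handed
to the empirical risk minimizer `erm`; one step for every example handed over and one for the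
call. -/
def train (ask : ι → Fin n → Run Bool) (point : ι → X) (erm : List (X × Bool) → X → Bool)
    (w : Fin n) (s : Fin m → ι) : Run (X → Bool) :=
  (Run.forAll (fun j => (ask (s j) w).bind fun b => Run.step (point (s j), b))
    (List.finRange m)).bind fun S => Run.step (erm S)

/-- The three-step algorithm; it returns the worker identified in Step 2 and the hypothesis learned
in Step 3. -/
def threeStep [NeZero n] (ask : ι → Fin n → Run Bool) (point : ι → X)
    (erm : List (X × Bool) → X → Bool) (g : Fin T → ι) (v : Fin T → Fin L → Fin n)
    (s : Fin m → ι) : Run (Fin n × (X → Bool)) :=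
  (groundTruth ask g v).bind fun G => (bestWorker ask G).bind fun w =>
    (train ask point erm w s).bind fun h => Run.pure (w, h)

end Algorithm

/-! ### The crowd -/

/-- A data point: an instance, together with the workers that mislabel it.  A worker who is asked
twice about the same data point gives the same label twice. -/
abbrev Item (X : Type*) (n : ℕ) : Type _ := X × (Fin n → Bool)

/-- Asking worker `w` for the label of the data point `z`, when the target concept is `c`:
one task, one step. -/
def askWorker {X : Type*} {n : ℕ} (c : X → Bool) (z : Item X n) (w : Fin n) : Run Bool :=
  ⟨xor (c z.1) (z.2 w), 1, 1⟩

/-- The law of a data point: the instance is drawn from `D`, and, independently, each worker `w`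
mislabels it with probability `η w`, independently of the other workers. -/
noncomputable def itemLaw {X : Type*} [MeasurableSpace X] {n : ℕ} (D : Measure X)
    (η : Fin n → unitInterval) : Measure (Item X n) :=
  D.prod (Measure.pi fun w => bernoulliMeasure true false (η w))

/-- Outcomes: the data points and the voters of Step 1, and the data points of Step 3. -/
abbrev Outcome (X : Type*) (n T L m : ℕ) : Type _ :=
  ((Fin T → Item X n) × (Fin T → Fin L → Fin n)) × (Fin m → Item X n)

/-- All data points are drawn independently; for each data point of Step 1, independently, the
`L` voters are `L` distinct workers, drawn uniformly at random. -/
noncomputable def outcomeLaw {X : Type*} [MeasurableSpace X] {n : ℕ} (D : Measure X)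
    (η : Fin n → unitInterval) (T L m : ℕ) : Measure (Outcome X n T L m) :=
  ((Measure.pi fun _ : Fin T => itemLaw D η).prod
    (Measure.pi fun _ : Fin T => uniformOn {v : Fin L → Fin n | Function.Injective v})).prod
    (Measure.pi fun _ : Fin m => itemLaw D η)

/-- The algorithm run with the crowd on an outcome. -/
def crowdRun {X : Type*} {n T L m : ℕ} [NeZero n] (c : X → Bool)
    (erm : List (X × Bool) → X → Bool) (ω : Outcome X n T L m) : Run (Fin n × (X → Bool)) :=
  threeStep (askWorker c) Prod.fst erm ω.1.1 ω.1.2 ω.2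

/-- The average noise rate of the crowd. -/
noncomputable def avgRate {n : ℕ} (η : Fin n → unitInterval) : ℝ := (∑ w, (η w : ℝ)) / n

/-- The noise rate of the best worker. -/
noncomputable def bestRate {n : ℕ} (η : Fin n → unitInterval) : ℝ := ⨅ w, (η w : ℝ)

/-- A `Δ`-optimal worker. -/
def IsOptimalWorker {n : ℕ} (η : Fin n → unitInterval) (Δ : ℝ) (w : Fin n) : Prop :=
  (η w : ℝ) ≤ bestRate η + Δ

/-! ### Concept classes -/

/-- The class `𝒞` shatters the finite set `S`. -/
def ShattersSet {X : Type*} (𝒞 : Set (X → Bool)) (S : Finset X) : Prop :=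
  ∀ f : X → Bool, ∃ h ∈ 𝒞, ∀ x ∈ S, h x = f x

/-- The VC dimension of a concept class. -/
noncomputable def vcDimension {X : Type*} (𝒞 : Set (X → Bool)) : ℕ∞ :=
  ⨆ (S : Finset X) (_ : ShattersSet 𝒞 S), (S.card : ℕ∞)

/-- A countable subclass is sequentially dense for pointwise convergence (the usual measurability
convention for uncountable classes; every countable class satisfies it). -/
def UniversallySeparable {X : Type*} (𝒞 : Set (X → Bool)) : Prop :=
  ∃ 𝒞₀ ⊆ 𝒞, 𝒞₀.Countable ∧
    ∀ h ∈ 𝒞, ∃ u : ℕ → X → Bool, (∀ k, u k ∈ 𝒞₀) ∧ ∀ x, ∀ᶠ k in atTop, u k x = h x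

/-- The number of examples of a labelled sample with which `h` disagrees. -/
def disagreements {X : Type*} (h : X → Bool) (S : List (X × Bool)) : ℕ :=
  S.countP fun p => h p.1 != p.2

/-- `erm` returns, for each labelled sample, a concept of the class with the fewest
disagreements. -/
def IsERM {X : Type*} (𝒞 : Set (X → Bool)) (erm : List (X × Bool) → X → Bool) : Prop :=
  ∀ S, erm S ∈ 𝒞 ∧ ∀ h ∈ 𝒞, disagreements (erm S) S ≤ disagreements h S

/-! ### The parameters and the bound -/

/-- The accuracy `Δ` with which Step 2 identifies a good worker. -/
noncomputable def gap {n : ℕ} (η : Fin n → unitInterval) : ℝ := (1 / 2 - bestRate η) / 2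

/-- The number `⌈A log(n/δ) / Δ²⌉` of ground-truth points. -/
noncomputable def truthSize {n : ℕ} (A : ℝ) (η : Fin n → unitInterval) (δ : ℝ) : ℕ :=
  ⌈A * Real.log (n / δ) / gap η ^ 2⌉₊

/-- The number `⌈A log(T/δ) / (1 - 2η̄)²⌉` of votes for each of the `T` ground-truth points. -/
noncomputable def votesPerPoint {n : ℕ} (A : ℝ) (η : Fin n → unitInterval) (δ : ℝ) : ℕ :=
  ⌈A * Real.log (truthSize A η δ / δ) / (1 - 2 * avgRate η) ^ 2⌉₊

/-- The task complexity, without constants and suppressed factors. -/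
noncomputable def taskBound {n : ℕ} (η : Fin n → unitInterval) (d : ℕ) (ε δ : ℝ) : ℝ :=
  Real.log (n / δ) ^ 2 / ((1 - 2 * bestRate η) ^ 2 * (1 - 2 * avgRate η) ^ 2)
    + (n + d / ε) * Real.log (1 / δ) / (1 - 2 * bestRate η) ^ 2

/-- The logarithm whose powers are suppressed by the soft-O notation. -/
noncomputable def softLog {n : ℕ} (η : Fin n → unitInterval) (ε : ℝ) : ℝ :=
  Real.log (2 + n + 1 / ε + 1 / (1 - 2 * bestRate η))

open scoped ENNReal

/-! ### Exponential moments of product measures -/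

/-! The algorithm can fail in three ways: a majority vote is wrong, the empirical error rate of some
worker is off by more than `Δ / 2`, or the training sample labelled by some `Δ`-optimal worker
admits a bad hypothesis that fits it as well as the target. Outside these events the returned pair
is good by a deterministic argument. A union bound then suffices, and no independence between the
events is needed, although the same persistent noise enters both the votes and the comparison of
workers.

The votes and the error rates are Chernoff bounds, all drawn from one exponential-moment inequality,
`measure_pi_le_prod`. The voters are distinct, so the factors of a vote are not independent draws
from the crowd. Maclaurin's inequality for elementary symmetric means (`sum_injective_prod_le`)
bounds the mean of the product by the power of the mean. Since the moment factor of a worker is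
affine in the noise rate, that mean is the factor of a single worker with rate `avgRate η`.

For learning, minimality of the empirical risk forces the noise to be wrong on at least half of the
sample points where the hypothesis differs from the target (`Misleading`). If this disagreement
region has mass at least `ε`, then either the sample hits it unusually rarely or the noise wins a
majority on many hits. The first is excluded by the double-sample argument with random swaps
(`exists_sparse_le`). The second is excluded by a Chernoff bound with the instances fixed
(`noise_misleading_le`). In both cases Sauer-Shelah reduces the class to finitely many traces.
Relative deviations, instead of uniform convergence of risks, give the rate `1 / ε` rather than `1 /
ε ^ 2`. Universal separability reduces everything to a countable class, where the events are
measurable.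

What remains is the choice of constants. They depend only on a positive lower bound `c₀` for `log (1
/ δ)`, which absorbs roundings and additive constants into logarithms. -/

theorem lintegral_pi_prod {ι : Type*} [Fintype ι] {E : ι → Type*} [∀ i, MeasurableSpace (E i)]
    (μ : ∀ i, Measure (E i)) [∀ i, IsProbabilityMeasure (μ i)] (s : Finset ι)
    (f : ∀ i, E i → ℝ≥0∞) (hf : ∀ i, Measurable (f i)) :
    ∫⁻ x, ∏ i ∈ s, f i (x i) ∂(Measure.pi μ) = ∏ i ∈ s, ∫⁻ y, f i y ∂(μ i) := by
  refine (lintegral_prod_eq_prod_lintegral_of_indepFun s (fun i (x : ∀ i, E i) => f i (x i))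
    (iIndepFun_pi fun i => (hf i).aemeasurable)
    fun i => (hf i).comp (measurable_pi_apply i)).trans ?_
  exact Finset.prod_congr rfl fun i _ => (measurePreserving_eval μ i).lintegral_comp (hf i)

/-- The general Chernoff bound: Markov's inequality at level 1, followed by factorization over
independent coordinates. The event itself need not be measurable, because it is first enlarged to a
superlevel set. -/
theorem measure_pi_le_prod {ι : Type*} [Fintype ι] {E : ι → Type*} [∀ i, MeasurableSpace (E i)]
    (μ : ∀ i, Measure (E i)) [∀ i, IsProbabilityMeasure (μ i)] (s : Finset ι)
    (f : ∀ i, E i → ℝ≥0∞) (hf : ∀ i, Measurable (f i)) (A : Set (∀ i, E i))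
    (hA : ∀ x ∈ A, 1 ≤ ∏ i ∈ s, f i (x i)) :
    Measure.pi μ A ≤ ∏ i ∈ s, ∫⁻ y, f i y ∂(μ i) := by
  rw [← lintegral_pi_prod μ s f hf]
  refine (measure_mono (t := {x : ∀ i, E i | 1 ≤ ∏ i ∈ s, f i (x i)}) hA).trans ?_
  have hm : Measurable fun x : ∀ i, E i => ∏ i ∈ s, f i (x i) :=
    Finset.measurable_prod _ fun i _ => (hf i).comp (measurable_pi_apply i)
  simpa using mul_meas_ge_le_lintegral (μ := Measure.pi μ) hm 1

theorem lintegral_bernoulli (p : unitInterval) (g : Bool → ℝ≥0∞) :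
    ∫⁻ b, g b ∂(bernoulliMeasure true false p)
      = ENNReal.ofReal p * g true + ENNReal.ofReal (1 - p) * g false := by
  rw [bernoulliMeasure_def, lintegral_add_measure, lintegral_smul_measure, lintegral_smul_measure,
    lintegral_dirac, lintegral_dirac]
  have h1 : ((unitInterval.toNNReal p : NNReal) : ℝ≥0∞) = ENNReal.ofReal p := by
    rw [ENNReal.ofReal, Real.toNNReal_of_nonneg p.2.1]; rfl
  have h2 : ((unitInterval.toNNReal (unitInterval.symm p) : NNReal) : ℝ≥0∞)
      = ENNReal.ofReal (1 - p) := by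
    rw [ENNReal.ofReal, Real.toNNReal_of_nonneg (by linarith [p.2.2])]; rfl
  rw [ENNReal.smul_def, ENNReal.smul_def, h1, h2, smul_eq_mul, smul_eq_mul]

theorem lintegral_bernoulli_ofReal (p : unitInterval) (g : Bool → ℝ) (hg : ∀ b, 0 ≤ g b) :
    ∫⁻ b, ENNReal.ofReal (g b) ∂(bernoulliMeasure true false p)
      = ENNReal.ofReal (p * g true + (1 - p) * g false) := by
  have h1 : (0 : ℝ) ≤ p := p.2.1
  have h2 : (0 : ℝ) ≤ 1 - p := by linarith [p.2.2]
  rw [lintegral_bernoulli, ENNReal.ofReal_add (mul_nonneg h1 (hg _)) (mul_nonneg h2 (hg _)),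
    ENNReal.ofReal_mul h1, ENNReal.ofReal_mul h2]

/-! ### Two scalar inequalities -/

/-- With margin `g = 1 - 2p` the left side is `cosh g - g * sinh g`, which is at most `exp (g² / 2)
- g²` and hence at most `1 - g² / 4`. The margin itself serves as the exponent in place of the
optimal tilt, at the price of a constant. -/
theorem tilted_bernoulli_le {p : ℝ} (hp0 : 0 ≤ p) (hp : p ≤ 1 / 2) :
    p * Real.exp (1 - 2 * p) + (1 - p) * Real.exp (-(1 - 2 * p))
      ≤ Real.exp (-((1 - 2 * p) ^ 2 / 4)) := by
  obtain ⟨g, rfl⟩ : ∃ g, p = (1 - g) / 2 := ⟨1 - 2 * p, by ring⟩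
  have e : 1 - 2 * ((1 - g) / 2) = g := by ring
  rw [e]
  have g0 : 0 ≤ g := by linarith
  have g1 : g ≤ 1 := by linarith
  have h1 : Real.cosh g ≤ Real.exp (g ^ 2 / 2) := Real.cosh_le_exp_half_sq g
  have h2 : g ≤ Real.sinh g := Real.self_le_sinh_iff.2 g0
  have h3 : Real.exp (g ^ 2 / 2) ≤ 1 + g ^ 2 / 2 + (g ^ 2 / 2) ^ 2 := by
    have := Real.abs_exp_sub_one_sub_id_le (x := g ^ 2 / 2)
      (by rw [abs_of_nonneg (by positivity)]; nlinarith)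
    linarith [(abs_le.1 this).2]
  have h4 : -(g ^ 2 / 4) + 1 ≤ Real.exp (-(g ^ 2 / 4)) := Real.add_one_le_exp _
  rw [Real.cosh_eq] at h1
  rw [Real.sinh_eq] at h2
  have h5 : g * g ≤ g * ((Real.exp g - Real.exp (-g)) / 2) := mul_le_mul_of_nonneg_left h2 g0
  have h6 : (g ^ 2) ^ 2 ≤ g ^ 2 := by
    have : g ^ 2 ≤ 1 := by nlinarith
    nlinarith [sq_nonneg g]
  nlinarith

/-- In `exp y ≤ 1 + y + y²` the linear terms cancel, and the variance `p * (1 - p)` is at most `1 /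
4`. -/
theorem centered_bernoulli_le {p l : ℝ} (hp0 : 0 ≤ p) (hp : p ≤ 1) (hl : |l| ≤ 1) :
    p * Real.exp (l * (1 - p)) + (1 - p) * Real.exp (l * (0 - p)) ≤ Real.exp (l ^ 2 / 4) := by
  have key : ∀ y : ℝ, |y| ≤ 1 → Real.exp y ≤ 1 + y + y ^ 2 := fun y hy => by
    linarith [(abs_le.1 (Real.abs_exp_sub_one_sub_id_le hy)).2]
  have h1 := key (l * (1 - p)) (by
    rw [abs_mul]
    exact mul_le_one₀ hl (abs_nonneg _) (abs_le.2 ⟨by linarith, by linarith⟩))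
  have h2 := key (l * (0 - p)) (by
    rw [abs_mul]
    exact mul_le_one₀ hl (abs_nonneg _) (abs_le.2 ⟨by linarith, by linarith⟩))
  have h3 := mul_le_mul_of_nonneg_left h1 hp0
  have h4 := mul_le_mul_of_nonneg_left h2 (sub_nonneg.2 hp)
  have h5 : l ^ 2 / 4 + 1 ≤ Real.exp (l ^ 2 / 4) := Real.add_one_le_exp _
  nlinarith [mul_nonneg (sq_nonneg l) (sq_nonneg (2 * p - 1))]

/-! ### Tail bounds -/

/-- The vote of a single worker, tilted by the margin `s`. -/
noncomputable def tilt (s : ℝ) (b : Bool) : ℝ := Real.exp (if b then s else -s)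

theorem tilt_nonneg (s : ℝ) (b : Bool) : 0 ≤ tilt s b := (Real.exp_pos _).le

theorem prod_tilt {ι : Type*} (H : Finset ι) (s : ℝ) (z : ι → Bool) :
    ∏ i ∈ H, tilt s (z i)
      = Real.exp (s * (2 * ((H.filter fun i => z i = true).card : ℝ) - H.card)) := by
  simp only [tilt]
  rw [← Real.exp_sum]
  congr 1
  rw [Finset.card_filter]
  push_cast
  rw [Finset.card_eq_sum_ones]
  push_cast
  rw [Finset.mul_sum, ← Finset.sum_sub_distrib, Finset.mul_sum]
  refine Finset.sum_congr rfl fun i _ => ?_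
  split_ifs <;> ring

theorem one_le_prod_tilt {ι : Type*} (H : Finset ι) {s : ℝ} (hs : 0 ≤ s) (z : ι → Bool)
    (h : H.card ≤ 2 * (H.filter fun i => z i = true).card) : 1 ≤ ∏ i ∈ H, tilt s (z i) := by
  rw [prod_tilt]
  refine Real.one_le_exp (mul_nonneg hs ?_)
  have : (H.card : ℝ) ≤ 2 * ((H.filter fun i => z i = true).card : ℝ) := by exact_mod_cast h
  linarith

/-- Few of the coordinates in `H` are expected to be `true`; the majority rarely is. -/
theorem bernoulli_majority_le {ι : Type*} [Fintype ι] (p : unitInterval) (hp : (p : ℝ) ≤ 1 / 2)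
    (H : Finset ι) :
    Measure.pi (fun _ : ι => bernoulliMeasure true false p)
        {z | H.card ≤ 2 * (H.filter fun i => z i = true).card}
      ≤ ENNReal.ofReal (Real.exp (-(H.card * (1 - 2 * (p : ℝ)) ^ 2 / 4))) := by
  refine (measure_pi_le_prod _ H (fun _ b => ENNReal.ofReal (tilt (1 - 2 * p) b))
    (fun _ => measurable_of_countable _) _ fun z hz => ?_).trans ?_
  · rw [← ENNReal.ofReal_prod_of_nonneg fun i _ => tilt_nonneg _ _]
    exact ENNReal.one_le_ofReal.2 (one_le_prod_tilt H (by linarith) z hz)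
  · rw [Finset.prod_const, lintegral_bernoulli_ofReal _ _ (tilt_nonneg _),
      ← ENNReal.ofReal_pow (by
        have := p.2.1; have := p.2.2
        exact add_nonneg (mul_nonneg p.2.1 (Real.exp_pos _).le)
          (mul_nonneg (by linarith) (Real.exp_pos _).le))]
    refine ENNReal.ofReal_le_ofReal ?_
    have h := tilted_bernoulli_le p.2.1 hp
    rw [show -((H.card : ℝ) * (1 - 2 * (p : ℝ)) ^ 2 / 4)
      = (H.card : ℝ) * -((1 - 2 * (p : ℝ)) ^ 2 / 4) by ring, Real.exp_nat_mul]
    refine pow_le_pow_left₀ ?_ (by simpa [tilt] using h) _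
    exact add_nonneg (mul_nonneg p.2.1 (Real.exp_pos _).le)
          (mul_nonneg (by linarith [p.2.2]) (Real.exp_pos _).le)

/-- The sign of `l` is free, so one statement serves both tails; the threshold is spread over the
coordinates as a factor `exp (-c)` each. -/
theorem bernoulli_deviation_aux {T : ℕ} (p : unitInterval) {l c : ℝ} (hl : |l| ≤ 1)
    (A : Set (Fin T → Bool))
    (hA : ∀ z ∈ A, T * c ≤ l * (((Finset.univ.filter fun i => z i = true).card : ℝ) - T * p)) :
    Measure.pi (fun _ : Fin T => bernoulliMeasure true false p) A
      ≤ ENNReal.ofReal (Real.exp (T * (l ^ 2 / 4 - c))) := by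
  have hpos : 0 ≤ (p : ℝ) * Real.exp (l * (1 - p)) + (1 - p) * Real.exp (l * (0 - p)) :=
    add_nonneg (mul_nonneg p.2.1 (Real.exp_pos _).le)
      (mul_nonneg (by linarith [p.2.2]) (Real.exp_pos _).le)
  refine (measure_pi_le_prod _ Finset.univ (fun _ b => ENNReal.ofReal (Real.exp (-c) *
        Real.exp (l * ((if b = true then 1 else 0) - p))))
      (fun _ => measurable_of_countable _) _ fun z hz => ?_).trans ?_
  · rw [← ENNReal.ofReal_prod_of_nonneg fun i _ => by positivity]
    refine ENNReal.one_le_ofReal.2 ?_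
    rw [Finset.prod_mul_distrib, ← Real.exp_sum, ← Real.exp_sum, ← Real.exp_add]
    refine Real.one_le_exp ?_
    have := hA z hz
    rw [← Finset.mul_sum, Finset.sum_sub_distrib, Finset.sum_const, Finset.sum_const,
      Finset.sum_boole, Finset.card_univ, Fintype.card_fin, nsmul_eq_mul, nsmul_eq_mul]
    linarith
  rw [Finset.prod_const, lintegral_bernoulli_ofReal _ _ fun b => by positivity, Finset.card_univ,
    Fintype.card_fin]
  have e : (p : ℝ) * (Real.exp (-c) * Real.exp (l * ((if true = true then 1 else 0) - p)))
      + (1 - p) * (Real.exp (-c) * Real.exp (l * ((if false = true then 1 else 0) - p)))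
      = Real.exp (-c) *
        (p * Real.exp (l * (1 - p)) + (1 - p) * Real.exp (l * (0 - p))) := by
    simp; ring
  rw [e, ← ENNReal.ofReal_pow (by positivity), Real.exp_nat_mul]
  refine ENNReal.ofReal_le_ofReal (pow_le_pow_left₀ (by positivity) ?_ _)
  rw [show l ^ 2 / 4 - c = -c + l ^ 2 / 4 by ring, Real.exp_add]
  exact mul_le_mul_of_nonneg_left (centered_bernoulli_le p.2.1 p.2.2 hl) (Real.exp_pos _).le

/-- Hoeffding's inequality (with a worse constant) for a fixed worker. -/
theorem bernoulli_deviation_le {T : ℕ} (p : unitInterval) {a : ℝ} (ha0 : 0 ≤ a) (ha : a ≤ 1) :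
    Measure.pi (fun _ : Fin T => bernoulliMeasure true false p)
        {z | T * (a / 2) < |((Finset.univ.filter fun i => z i = true).card : ℝ) - T * p|}
      ≤ 2 * ENNReal.ofReal (Real.exp (-(T * a ^ 2 / 4))) := by
  have h1 := bernoulli_deviation_aux (T := T) p (l := a) (c := a ^ 2 / 2) (abs_le.2 ⟨by linarith, ha⟩)
    {z | T * (a / 2) < ((Finset.univ.filter fun i => z i = true).card : ℝ) - T * p}
    fun z hz => by
      have := mul_le_mul_of_nonneg_left (le_of_lt hz) ha0
      linarith
  have h2 := bernoulli_deviation_aux (T := T) p (l := -a) (c := a ^ 2 / 2)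
    (by rw [abs_neg]; exact abs_le.2 ⟨by linarith, ha⟩)
    {z | T * (a / 2) < -(((Finset.univ.filter fun i => z i = true).card : ℝ) - T * p)}
    fun z hz => by
      have := mul_le_mul_of_nonneg_left (le_of_lt hz) ha0
      linarith
  rw [show (T : ℝ) * (a ^ 2 / 4 - a ^ 2 / 2) = -(T * a ^ 2 / 4) by ring] at h1
  rw [show (T : ℝ) * ((-a) ^ 2 / 4 - a ^ 2 / 2) = -(T * a ^ 2 / 4) by ring] at h2
  rw [two_mul]
  refine ((measure_mono fun z hz => ?_).trans (measure_union_le _ _)).trans (add_le_add h1 h2)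
  exact lt_abs.1 (Set.mem_ofPred.1 hz)

/-- A set of mass at least `ε` is hit at least half as often as expected, with probability at
least one half. -/
theorem few_hits_le {X : Type*} [MeasurableSpace X] (D : Measure X) [IsProbabilityMeasure D]
    {m : ℕ} {ε : ℝ} (hm : 6 ≤ m * ε) {S : Set X} (hS : MeasurableSet S) (hε : ε ≤ D.real S)
    [DecidablePred (· ∈ S)] :
    Measure.pi (fun _ : Fin m => D)
        {x | 2 * ((Finset.univ.filter fun i => x i ∈ S).card : ℝ) < m * ε} ≤ 1 / 2 := by
  -- Each hit contributes `exp (-1)` and each draw `exp (ε / 2)`, so the product is `exp (m * ε / 2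
  -- - hits)`.
  set f : X → ℝ := fun x => Real.exp (ε / 2) * Real.exp (if x ∈ S then -1 else 0) with hf
  have hfm : Measurable f :=
    (Real.measurable_exp.comp (Measurable.ite hS measurable_const measurable_const)).const_mul _
  refine (measure_pi_le_prod _ Finset.univ (fun _ y => ENNReal.ofReal (f y))
    (fun _ => hfm.ennreal_ofReal) _ fun x hx => ?_).trans ?_
  · rw [← ENNReal.ofReal_prod_of_nonneg fun i _ => by positivity]
    refine ENNReal.one_le_ofReal.2 ?_
    simp only [hf]
    rw [Finset.prod_mul_distrib, ← Real.exp_sum, ← Real.exp_sum, ← Real.exp_add]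
    refine Real.one_le_exp ?_
    have h0 : ∑ i : Fin m, (if x i ∈ S then (-1 : ℝ) else 0)
        = -((Finset.univ.filter fun i => x i ∈ S).card : ℝ) := by
      rw [← Finset.sum_boole, ← Finset.sum_neg_distrib]
      exact Finset.sum_congr rfl fun i _ => by split_ifs <;> simp
    rw [h0, Finset.sum_const, Finset.card_univ, Fintype.card_fin, nsmul_eq_mul]
    have : 2 * ((Finset.univ.filter fun i => x i ∈ S).card : ℝ) < m * ε := hx
    linarith
  -- Since `1 - exp (-1)` exceeds `63 / 100`, the exponent per draw is at most `(50 - 63) / 100 *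
  -- ε`. With `m * ε ≥ 6` the total is at most `-0.78`, below `-log 2`.
  · have hint : ∫⁻ y, ENNReal.ofReal (f y) ∂D
        ≤ ENNReal.ofReal (Real.exp (-(13 / 100 * ε))) := by
      have hi : Integrable f D := by
        refine Integrable.of_bound hfm.aestronglyMeasurable (Real.exp (ε / 2)) (.of_forall fun y => ?_)
        rw [Real.norm_of_nonneg (by positivity)]
        refine mul_le_of_le_one_right (Real.exp_pos _).le (Real.exp_le_one_iff.2 ?_)
        split_ifs <;> norm_num
      rw [← ofReal_integral_eq_lintegral_ofReal hi (.of_forall fun y => by positivity)]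
      refine ENNReal.ofReal_le_ofReal ?_
      have e : ∀ y, f y = Real.exp (ε / 2) - Real.exp (ε / 2) * (1 - Real.exp (-1)) *
          S.indicator (fun _ => (1 : ℝ)) y := fun y => by
        by_cases hy : y ∈ S <;> simp [hf, hy]
        ring
      have hval : ∫ y, f y ∂D = Real.exp (ε / 2) * (1 - (1 - Real.exp (-1)) * D.real S) := by
        simp_rw [e]
        rw [integral_sub (integrable_const _)
          (((integrable_const (1 : ℝ)).indicator hS).const_mul _), integral_const_mul,
          integral_indicator hS]
        simp
        ring
      rw [hval]
      have h1 := Real.exp_neg_one_lt_d9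
      have h2 : 1 - (1 - Real.exp (-1)) * D.real S ≤ Real.exp (-(63 / 100 * ε)) := by
        have := Real.add_one_le_exp (-(63 / 100 * ε))
        have h0 : 0 ≤ D.real S := measureReal_nonneg
        nlinarith
      calc _ ≤ Real.exp (ε / 2) * Real.exp (-(63 / 100 * ε)) :=
            mul_le_mul_of_nonneg_left h2 (Real.exp_pos _).le
        _ = _ := by rw [← Real.exp_add]; congr 1; ring
    rw [Finset.prod_const, Finset.card_univ, Fintype.card_fin]
    refine (pow_le_pow_left₀ zero_le hint m).trans ?_
    rw [← ENNReal.ofReal_pow (Real.exp_pos _).le, ← Real.exp_nat_mul]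
    have h3 : Real.exp (m * -(13 / 100 * ε)) ≤ 1 / 2 := by
      have h4 : (m : ℝ) * -(13 / 100 * ε) ≤ -Real.log 2 := by
        have := Real.log_two_lt_d9
        nlinarith
      calc _ ≤ Real.exp (-Real.log 2) := Real.exp_le_exp.2 h4
        _ = 1 / 2 := by rw [Real.exp_neg, Real.exp_log (by norm_num)]; norm_num
    refine (ENNReal.ofReal_le_ofReal h3).trans (le_of_eq ?_)
    rw [ENNReal.ofReal_div_of_pos (by norm_num)]; simp

/-! ### Products along a random permutation -/

/-- Adding an index to a product along a random permutation multiplies the sum at most by the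
mean. -/
theorem sum_perm_prod_insert_le {n : ℕ} (f : Fin n → ℝ) (hf : ∀ i, 0 ≤ f i) (V : Finset (Fin n))
    (a : Fin n) (ha : a ∉ V) :
    n * ∑ σ : Equiv.Perm (Fin n), ∏ i ∈ insert a V, f (σ i)
      ≤ (∑ i, f i) * ∑ σ : Equiv.Perm (Fin n), ∏ i ∈ V, f (σ i) := by
  -- The new index may be compared with any index `b`. For `b` outside `V` the two sums agree after
  -- exchanging `a` and `b`. For `b` in `V` the right side has a square, and `2xy ≤ x² + y²`
  -- together with the same exchange gives the inequality. Summing over `b` turns `f (σ b)` into the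
  -- total of `f`.
  have key : ∀ b : Fin n, ∑ σ : Equiv.Perm (Fin n), ∏ i ∈ insert a V, f (σ i)
      ≤ ∑ σ : Equiv.Perm (Fin n), f (σ b) * ∏ i ∈ V, f (σ i) := by
    intro b
    by_cases hb : b ∈ V
    · have hsplit : ∀ σ : Equiv.Perm (Fin n),
          ∏ i ∈ V, f (σ i) = f (σ b) * ∏ i ∈ V.erase b, f (σ i) := fun σ =>
        (Finset.mul_prod_erase V (fun i => f (σ i)) hb).symm
      have hab : a ≠ b := fun h => ha (h ▸ hb)
      have hswap : ∑ σ : Equiv.Perm (Fin n), f (σ b) ^ 2 * ∏ i ∈ V.erase b, f (σ i)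
          = ∑ σ : Equiv.Perm (Fin n), f (σ a) ^ 2 * ∏ i ∈ V.erase b, f (σ i) := by
        refine Fintype.sum_equiv (Equiv.mulRight (Equiv.swap a b)) _ _ fun σ => ?_
        simp only [Equiv.coe_mulRight, Equiv.Perm.mul_apply, Equiv.swap_apply_left]
        congr 1
        refine Finset.prod_congr rfl fun i hi => ?_
        rw [Equiv.swap_apply_of_ne_of_ne]
        · rintro rfl; exact ha (Finset.mem_of_mem_erase hi)
        · exact Finset.ne_of_mem_erase hi
      have hterm : ∀ σ : Equiv.Perm (Fin n), 2 * ∏ i ∈ insert a V, f (σ i)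
          ≤ f (σ a) ^ 2 * (∏ i ∈ V.erase b, f (σ i))
            + f (σ b) ^ 2 * (∏ i ∈ V.erase b, f (σ i)) := fun σ => by
        rw [Finset.prod_insert ha, hsplit σ]
        have h0 : 0 ≤ ∏ i ∈ V.erase b, f (σ i) := Finset.prod_nonneg fun i _ => hf _
        nlinarith [mul_nonneg (sq_nonneg (f (σ a) - f (σ b))) h0]
      have := Finset.sum_le_sum fun σ (_ : σ ∈ Finset.univ) => hterm σ
      rw [← Finset.mul_sum, Finset.sum_add_distrib, ← hswap] at this
      have h2 : ∑ σ : Equiv.Perm (Fin n), f (σ b) * ∏ i ∈ V, f (σ i)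
          = ∑ σ : Equiv.Perm (Fin n), f (σ b) ^ 2 * ∏ i ∈ V.erase b, f (σ i) :=
        Finset.sum_congr rfl fun σ _ => by rw [hsplit σ]; ring
      rw [h2]; linarith
    · refine le_of_eq ?_
      refine Fintype.sum_equiv (Equiv.mulRight (Equiv.swap a b)) _ _ fun σ => ?_
      simp only [Equiv.coe_mulRight, Equiv.Perm.mul_apply, Equiv.swap_apply_right,
        Finset.prod_insert ha]
      congr 1
      refine Finset.prod_congr rfl fun i hi => ?_
      rw [Equiv.swap_apply_of_ne_of_ne]
      · rintro rfl; exact ha hi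
      · rintro rfl; exact hb hi
  calc _ = ∑ _b : Fin n, ∑ σ : Equiv.Perm (Fin n), ∏ i ∈ insert a V, f (σ i) := by simp
    _ ≤ ∑ b : Fin n, ∑ σ : Equiv.Perm (Fin n), f (σ b) * ∏ i ∈ V, f (σ i) :=
        Finset.sum_le_sum fun b _ => key b
    _ = _ := by
        rw [Finset.sum_comm, Finset.mul_sum]
        refine Finset.sum_congr rfl fun σ _ => ?_
        rw [← Finset.sum_mul, Equiv.sum_comp σ f]

/-- Maclaurin's inequality. -/
theorem sum_perm_prod_le {n : ℕ} (f : Fin n → ℝ) (hf : ∀ i, 0 ≤ f i) (V : Finset (Fin n)) :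
    ∑ σ : Equiv.Perm (Fin n), ∏ i ∈ V, f (σ i)
      ≤ Fintype.card (Equiv.Perm (Fin n)) * ((∑ i, f i) / n) ^ V.card := by
  induction V using Finset.induction_on with
  | empty => simp
  | insert a V ha ih =>
    have hn : (0 : ℝ) < n := by exact_mod_cast a.pos
    have h := sum_perm_prod_insert_le f hf V a ha
    have hs : 0 ≤ ∑ i, f i := Finset.sum_nonneg fun i _ => hf i
    rw [Finset.card_insert_of_notMem ha, pow_succ]
    have h2 := mul_le_mul_of_nonneg_left ih hs
    rw [← mul_le_mul_iff_right₀ hn]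
    refine h.trans (h2.trans (le_of_eq ?_))
    field_simp

/-- Maclaurin's inequality for sampling without replacement. -/
theorem sum_injective_prod_le {n L : ℕ} (f : Fin n → ℝ) (hf : ∀ i, 0 ≤ f i)
    (I : Finset (Fin L → Fin n)) (hI : ∀ v, v ∈ I ↔ Function.Injective v) :
    ∑ v ∈ I, ∏ j, f (v j) ≤ I.card * ((∑ i, f i) / n) ^ L := by
  -- Composition with a permutation permutes the injections, so the sum may be averaged over all
  -- permutations; each injection then contributes a product along its image.
  have hinv : ∀ σ : Equiv.Perm (Fin n),
      ∑ v ∈ I, ∏ j, f (v j) = ∑ v ∈ I, ∏ j, f (σ (v j)) := fun σ => by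
    symm
    refine Finset.sum_bij' (fun v _ => σ ∘ v) (fun v _ => σ.symm ∘ v) ?_ ?_ ?_ ?_ ?_
    · intro v hv; exact (hI _).2 (σ.injective.comp ((hI v).1 hv))
    · intro v hv; exact (hI _).2 (σ.symm.injective.comp ((hI v).1 hv))
    · intro v _; ext; simp
    · intro v _; ext; simp
    · intro v _; simp
  have hP : (0 : ℝ) < Fintype.card (Equiv.Perm (Fin n)) := by exact_mod_cast Fintype.card_pos
  rw [← mul_le_mul_iff_right₀ hP]
  calc _ = ∑ σ : Equiv.Perm (Fin n), ∑ v ∈ I, ∏ j, f (σ (v j)) := by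
        rw [← Finset.sum_congr rfl fun σ _ => hinv σ]; simp
    _ = ∑ v ∈ I, ∑ σ : Equiv.Perm (Fin n), ∏ i ∈ Finset.univ.image v, f (σ i) := by
        rw [Finset.sum_comm]
        refine Finset.sum_congr rfl fun v hv => Finset.sum_congr rfl fun σ _ => ?_
        rw [Finset.prod_image fun a _ b _ h => (hI v).1 hv h]
    _ ≤ ∑ _v ∈ I, Fintype.card (Equiv.Perm (Fin n)) * ((∑ i, f i) / n) ^ L := by
        refine Finset.sum_le_sum fun v hv => (sum_perm_prod_le f hf _).trans (le_of_eq ?_)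
        rw [Finset.card_image_of_injective _ ((hI v).1 hv), Finset.card_univ, Fintype.card_fin]
    _ = _ := by rw [Finset.sum_const, nsmul_eq_mul]; ring

/-! ### The majority vote of random workers -/

theorem lintegral_uniformOn_finset {Ω : Type*} [MeasurableSpace Ω] [MeasurableSingletonClass Ω]
    (s : Finset Ω) (g : Ω → ℝ≥0∞) :
    ∫⁻ x, g x ∂(uniformOn (s : Set Ω)) = (s.card : ℝ≥0∞)⁻¹ * ∑ x ∈ s, g x := by
  rw [uniformOn, ProbabilityTheory.cond, lintegral_smul_measure, lintegral_finset, Measure.count_apply_finset]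
  simp

/-- The probability that the majority vote of `L` distinct random workers is wrong. -/
theorem crowd_majority_le {n L : ℕ} (hL : L ≤ n) (hn : 0 < n) (η : Fin n → unitInterval)
    (havg : avgRate η ≤ 1 / 2) :
    ((Measure.pi fun w => bernoulliMeasure true false (η w)).prod
        (uniformOn {v : Fin L → Fin n | Function.Injective v}))
        {q | L ≤ 2 * (Finset.univ.filter fun j => q.1 (q.2 j) = true).card}
      ≤ ENNReal.ofReal (Real.exp (-(L * (1 - 2 * avgRate η) ^ 2 / 4))) := by
  classical
  set I : Finset (Fin L → Fin n) := Finset.univ.filter Function.Injective with hIdef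
  have hI : ∀ v, v ∈ I ↔ Function.Injective v := fun v => by simp [hIdef]
  have hIc : {v : Fin L → Fin n | Function.Injective v} = (I : Set (Fin L → Fin n)) := by
    ext v; simp [hIdef]
  have hInon : I.Nonempty := ⟨Fin.castLE hL, (hI _).2 (Fin.castLE_injective hL)⟩
  have hIpos : (0 : ℝ) < I.card := by exact_mod_cast hInon.card_pos
  have hn' : (0 : ℝ) < n := by exact_mod_cast hn
  set s : ℝ := 1 - 2 * avgRate η with hs
  have hs0 : 0 ≤ s := by rw [hs]; linarith
  set f : Fin n → ℝ := fun w => η w * Real.exp s + (1 - η w) * Real.exp (-s) with hfdef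
  have hf : ∀ w, 0 ≤ f w := fun w => add_nonneg (mul_nonneg (η w).2.1 (Real.exp_pos _).le)
      (mul_nonneg (by linarith [(η w).2.2]) (Real.exp_pos _).le)
  have : IsProbabilityMeasure (uniformOn (I : Set (Fin L → Fin n))) :=
    isProbabilityMeasure_uniformOn I.finite_toSet hInon
  rw [hIc, Measure.prod_apply_symm (Set.toFinite _).measurableSet, lintegral_uniformOn_finset]
  have hsec : ∀ v ∈ I, (Measure.pi fun w => bernoulliMeasure true false (η w))
      ((fun z : Fin n → Bool => (z, v)) ⁻¹'
        {q | L ≤ 2 * (Finset.univ.filter fun j => q.1 (q.2 j) = true).card})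
      ≤ ENNReal.ofReal (∏ j, f (v j)) := by
    intro v hv
    have hinj := (hI v).1 hv
    have e : ∏ j, f (v j) = ∏ w ∈ Finset.univ.image v, f w := by
      rw [Finset.prod_image fun a _ b _ h => hinj h]
    rw [e, ENNReal.ofReal_prod_of_nonneg fun i _ => hf i]
    refine (measure_pi_le_prod _ (Finset.univ.image v) (fun _ b => ENNReal.ofReal (tilt s b))
      (fun _ => measurable_of_countable _) _ fun z hz => ?_).trans (le_of_eq ?_)
    · rw [← ENNReal.ofReal_prod_of_nonneg fun i _ => tilt_nonneg _ _]
      refine ENNReal.one_le_ofReal.2 ?_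
      rw [Finset.prod_image fun a _ b _ h => hinj h]
      exact one_le_prod_tilt Finset.univ hs0 (fun j => z (v j)) (by simpa using hz)
    · refine Finset.prod_congr rfl fun w _ => ?_
      rw [lintegral_bernoulli_ofReal _ _ (tilt_nonneg _)]
      simp [tilt, hfdef]
  -- Here individual rates disappear: all workers are tilted by the same crowd margin, so `f w` is
  -- affine in `η w` and its mean depends on the average rate alone.
  have hmean : (∑ w, f w) / n = avgRate η * Real.exp (1 - 2 * avgRate η)
      + (1 - avgRate η) * Real.exp (-(1 - 2 * avgRate η)) := by
    rw [← hs]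
    simp only [hfdef, Finset.sum_add_distrib, ← Finset.sum_mul, Finset.sum_sub_distrib, avgRate,
      Finset.sum_const, Finset.card_univ, Fintype.card_fin, nsmul_eq_mul, mul_one]
    field_simp
  have havg0 : 0 ≤ avgRate η :=
    div_nonneg (Finset.sum_nonneg fun w _ => (η w).2.1) hn'.le
  have hmean_le : (∑ w, f w) / n ≤ Real.exp (-(s ^ 2 / 4)) := by
    rw [hmean]; exact tilted_bernoulli_le havg0 havg
  have hmean0 : 0 ≤ (∑ w, f w) / n := div_nonneg (Finset.sum_nonneg fun w _ => hf w) hn'.le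
  calc _ ≤ (I.card : ℝ≥0∞)⁻¹ * ∑ v ∈ I, ENNReal.ofReal (∏ j, f (v j)) := by
        gcongr with v hv; exact hsec v hv
    _ = ENNReal.ofReal ((I.card : ℝ)⁻¹ * ∑ v ∈ I, ∏ j, f (v j)) := by
        rw [ENNReal.ofReal_mul (by positivity), ENNReal.ofReal_inv_of_pos hIpos,
          ENNReal.ofReal_natCast, ENNReal.ofReal_sum_of_nonneg]
        exact fun v _ => Finset.prod_nonneg fun j _ => hf _
    _ ≤ _ := by
        refine ENNReal.ofReal_le_ofReal ?_
        have h1 := sum_injective_prod_le f hf I hI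
        calc _ ≤ (I.card : ℝ)⁻¹ * (I.card * ((∑ i, f i) / n) ^ L) := by gcongr
          _ = ((∑ i, f i) / n) ^ L := by field_simp
          _ ≤ Real.exp (-(s ^ 2 / 4)) ^ L := pow_le_pow_left₀ hmean0 hmean_le _
          _ = _ := by rw [← Real.exp_nat_mul]; congr 1; ring

/-! ### Traces of a concept class on a sample -/

open Classical in
/-- The sets of indices that members of `𝒜` cut out of the sample `x`. -/
noncomputable def traces {ι X : Type*} [Fintype ι] (𝒜 : Set (Set X)) (x : ι → X) :
    Finset (Finset ι) :=
  Finset.univ.filter fun A => ∃ S ∈ 𝒜, ∀ i, i ∈ A ↔ x i ∈ S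

theorem mem_traces {ι X : Type*} [Fintype ι] {𝒜 : Set (Set X)} {x : ι → X} {A : Finset ι} :
    A ∈ traces 𝒜 x ↔ ∃ S ∈ 𝒜, ∀ i, i ∈ A ↔ x i ∈ S := by
  simp [traces]

/-- The sets on which members of the class `𝒞` differ from `c`. -/
def errorSets {X : Type*} (𝒞 : Set (X → Bool)) (c : X → Bool) : Set (Set X) :=
  (fun h => {x | h x ≠ c x}) '' 𝒞

theorem card_le_of_shattersSet {X : Type*} {𝒞 : Set (X → Bool)} {d : ℕ} (hd : vcDimension 𝒞 = d)
    {S : Finset X} (hS : ShattersSet 𝒞 S) : S.card ≤ d := by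
  have h : (S.card : ℕ∞) ≤ vcDimension 𝒞 :=
    le_iSup₂ (f := fun (S : Finset X) (_ : ShattersSet 𝒞 S) => (S.card : ℕ∞)) S hS
  rw [hd] at h
  exact_mod_cast h

/-- Taking differences with a fixed `c` only relabels patterns, so shattered indices give shattered
instances. Repeated instances cannot be separated, hence `x` is injective on a shattered index set
and no size is lost. -/
theorem card_le_of_shatters_traces {ι X : Type*} [Fintype ι] [DecidableEq ι]
    {𝒞 : Set (X → Bool)} {c : X → Bool}
    {d : ℕ} (hd : vcDimension 𝒞 = d) (x : ι → X) {s : Finset ι}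
    (hs : (traces (errorSets 𝒞 c) x).Shatters s) : s.card ≤ d := by
  classical
  have hreal : ∀ t ⊆ s, ∃ h ∈ 𝒞, ∀ i ∈ s, (h (x i) ≠ c (x i) ↔ i ∈ t) := by
    intro t ht
    obtain ⟨u, hu, hut⟩ := hs ht
    obtain ⟨_, ⟨h, hh, rfl⟩, hS⟩ := mem_traces.1 hu
    refine ⟨h, hh, fun i hi => ?_⟩
    have := hS i
    rw [← hut, Finset.mem_inter, this]
    simp [hi]
  have hinj : Set.InjOn x s := by
    intro i hi j hj hij
    by_contra hne
    obtain ⟨h, -, hh⟩ := hreal {i} (by simpa using hi)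
    have h1 := (hh i hi).2 (by simp)
    have h2 := (hh j hj).not.2 (by simpa using Ne.symm hne)
    rw [hij] at h1
    exact h2 h1
  rw [← Finset.card_image_of_injOn hinj]
  refine card_le_of_shattersSet hd fun f => ?_
  obtain ⟨h, hh, hh'⟩ := hreal (s.filter fun i => f (x i) ≠ c (x i)) (Finset.filter_subset _ _)
  refine ⟨h, hh, fun y hy => ?_⟩
  obtain ⟨i, hi, rfl⟩ := Finset.mem_image.1 hy
  have := hh' i hi
  simp only [Finset.mem_filter, hi, true_and] at this
  cases h1 : h (x i) <;> cases h2 : f (x i) <;> cases h3 : c (x i) <;> simp_all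

/-- With `r = d / N ≤ 1`, weighting by `r ^ d ≤ r ^ k` bounds the sum by the binomial expansion of
`(1 + r) ^ N`, which is at most `exp d`. -/
theorem sum_choose_le_pow {N d : ℕ} (hd : 1 ≤ d) (hdN : d ≤ N) :
    ((∑ k ∈ Finset.Iic d, N.choose k : ℕ) : ℝ) ≤ (Real.exp 1 * N / d) ^ d := by
  have hd0 : (0 : ℝ) < d := by exact_mod_cast hd
  have hN0 : (0 : ℝ) < N := by exact_mod_cast hd.trans hdN
  set r : ℝ := d / N with hr
  have hr0 : 0 < r := by positivity
  have hr1 : r ≤ 1 := by rw [hr, div_le_one hN0]; exact_mod_cast hdN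
  have h1 : r ^ d * ((∑ k ∈ Finset.Iic d, N.choose k : ℕ) : ℝ) ≤ (1 + r) ^ N := by
    push_cast
    rw [Finset.mul_sum, add_comm, add_pow]
    calc _ ≤ ∑ k ∈ Finset.Iic d, r ^ k * 1 ^ (N - k) * (N.choose k : ℝ) := by
          refine Finset.sum_le_sum fun k hk => ?_
          rw [one_pow, mul_one]
          exact mul_le_mul_of_nonneg_right
            (pow_le_pow_of_le_one hr0.le hr1 (Finset.mem_Iic.1 hk)) (Nat.cast_nonneg _)
      _ ≤ _ := by
          refine Finset.sum_le_sum_of_subset_of_nonneg ?_ fun k _ _ => by positivity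
          intro k hk
          exact Finset.mem_range.2 (Nat.lt_succ_of_le ((Finset.mem_Iic.1 hk).trans hdN))
  have h2 : (1 + r) ^ N ≤ Real.exp 1 ^ d := by
    calc (1 + r) ^ N ≤ Real.exp r ^ N :=
          pow_le_pow_left₀ (by positivity) (by linarith [Real.add_one_le_exp r]) _
      _ = Real.exp 1 ^ d := by
          rw [← Real.exp_nat_mul, ← Real.exp_nat_mul]; congr 1; rw [hr]; field_simp
  have h3 : Real.exp 1 * N / d = Real.exp 1 / r := by rw [hr]; field_simp
  rw [h3, div_pow, le_div_iff₀ (by positivity), mul_comm]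
  exact h1.trans h2

/-- The Sauer-Shelah bound. -/
theorem card_traces_le {ι X : Type*} [Fintype ι] {𝒞 : Set (X → Bool)} {c : X → Bool}
    {d : ℕ} (hd : vcDimension 𝒞 = d) (hd1 : 1 ≤ d) (hdN : d ≤ Fintype.card ι) (x : ι → X) :
    ((traces (errorSets 𝒞 c) x).card : ℝ) ≤ (Real.exp 1 * Fintype.card ι / d) ^ d := by
  classical
  refine le_trans ?_ (sum_choose_le_pow hd1 hdN)
  have hvc : (traces (errorSets 𝒞 c) x).vcDim ≤ d :=
    Finset.sup_le fun s hs => card_le_of_shatters_traces hd x (Finset.mem_shatterer.1 hs)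
  have := ((traces (errorSets 𝒞 c) x).card_le_card_shatterer.trans
    Finset.card_shatterer_le_sum_vcDim).trans
    (Finset.sum_le_sum_of_subset (Finset.Iic_subset_Iic.2 hvc))
  exact_mod_cast this

theorem traces_mono {ι X : Type*} [Fintype ι] {𝒜 ℬ : Set (Set X)} (h : 𝒜 ⊆ ℬ) (x : ι → X) :
    traces 𝒜 x ⊆ traces ℬ x := fun A hA => by
  obtain ⟨S, hS, hx⟩ := mem_traces.1 hA
  exact mem_traces.2 ⟨S, h hS, hx⟩

/-- In a class of dimension zero all concepts agree. -/
theorem eq_of_vcDimension_eq_zero {X : Type*} {𝒞 : Set (X → Bool)} (hd : vcDimension 𝒞 = 0)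
    {h c : X → Bool} (hh : h ∈ 𝒞) (hc : c ∈ 𝒞) : h = c := by
  by_contra hne
  obtain ⟨y, hy⟩ := Function.ne_iff.1 hne
  have : ShattersSet 𝒞 {y} := fun f => by
    by_cases hf : f y = h y
    · exact ⟨h, hh, by simp [hf]⟩
    · refine ⟨c, hc, ?_⟩
      cases h1 : f y <;> cases h2 : h y <;> cases h3 : c y <;> simp_all
  simpa using card_le_of_shattersSet (d := 0) (by simpa using hd) this

/-! ### Symmetrization -/

theorem half_exp_add_half_exp_neg_le (y : ℝ) :
    Real.exp y + Real.exp (-y) ≤ 2 * Real.exp (y ^ 2 / 2) := by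
  have := Real.cosh_le_exp_half_sq y
  rw [Real.cosh_eq] at this
  linarith

/-- Few random swaps move at least `K / 2` elements of `A` to the second half of the double
sample while leaving at most `K / 4` in the first. -/
theorem card_unbalanced_swaps_le {m : ℕ} (A : Finset (Fin m × Bool)) (K : ℝ) :
    ((Finset.univ.filter fun σ : Fin m → Bool =>
        4 * ((Finset.univ.filter fun i => (i, σ i) ∈ A).card : ℝ) ≤ K ∧
        K ≤ 2 * ((Finset.univ.filter fun i => (i, !σ i) ∈ A).card : ℝ)).card : ℝ)
      ≤ 2 ^ m * Real.exp (-(K / 36)) := by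
  set a : Fin m → Bool → ℝ := fun i b => if (i, b) ∈ A then 1 else 0 with ha
  have hcard : ∀ σ : Fin m → Bool,
      ((Finset.univ.filter fun i => (i, σ i) ∈ A).card : ℝ) = ∑ i, a i (σ i) := fun σ => by
    rw [← Finset.sum_boole]
  set N : ℝ := ∑ i, (a i true + a i false) with hN
  have hsum : ∀ σ : Fin m → Bool, ∑ i, a i (σ i) + ∑ i, a i (!σ i) = N := fun σ => by
    rw [← Finset.sum_add_distrib]
    refine Finset.sum_congr rfl fun i _ => ?_
    cases σ i <;> simp [add_comm]
  set B := Finset.univ.filter fun σ : Fin m → Bool =>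
        4 * ((Finset.univ.filter fun i => (i, σ i) ∈ A).card : ℝ) ≤ K ∧
        K ≤ 2 * ((Finset.univ.filter fun i => (i, !σ i) ∈ A).card : ℝ) with hB
  -- In an unbalanced swap the first half has at most half as many elements as the second. As the
  -- halves add up to `N`, they differ by at least `N / 3`.
  have hmem : ∀ σ ∈ B, N / 3 ≤ ∑ i, (a i (!σ i) - a i (σ i)) ∧ K / 2 ≤ N := by
    intro σ hσ
    obtain ⟨h1, h2⟩ := (Finset.mem_filter.1 hσ).2
    rw [hcard] at h1
    rw [hcard fun i => !σ i] at h2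
    have h3 := hsum σ
    have h4 : 0 ≤ ∑ i, a i (σ i) := Finset.sum_nonneg fun i _ => by
      simp only [ha]; split_ifs <;> norm_num
    rw [Finset.sum_sub_distrib]
    constructor <;> linarith
  rcases B.eq_empty_or_nonempty with h0 | ⟨σ₀, hσ₀⟩
  · rw [h0]; simp; positivity
  have hKN := (hmem σ₀ hσ₀).2
  -- The tilt `1 / 3` maximizes `l / 3 - l² / 2`, with value `1 / 18`. A pair with both or neither
  -- member in `A` contributes no variance, so `N` bounds the number of active pairs.
  have hprod : ∑ σ : Fin m → Bool, Real.exp (1 / 3 * ∑ i, (a i (!σ i) - a i (σ i)))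
      ≤ 2 ^ m * Real.exp (N / 18) := by
    calc _ = ∑ σ : Fin m → Bool, ∏ i, Real.exp (1 / 3 * (a i (!σ i) - a i (σ i))) := by
          refine Finset.sum_congr rfl fun σ _ => ?_
          rw [Finset.mul_sum, Real.exp_sum]
      _ = ∏ i, ∑ b : Bool, Real.exp (1 / 3 * (a i (!b) - a i b)) := by
          rw [Finset.prod_univ_sum, Fintype.piFinset_univ]
      _ ≤ ∏ i : Fin m, 2 * Real.exp ((a i true + a i false) / 18) := by
          refine Finset.prod_le_prod (fun i _ => by positivity) fun i _ => ?_
          rw [Fintype.sum_bool]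
          have := half_exp_add_half_exp_neg_le (1 / 3 * (a i false - a i true))
          rw [show -(1 / 3 * (a i false - a i true)) = 1 / 3 * (a i true - a i false) by ring]
            at this
          refine this.trans ?_
          refine mul_le_mul_of_nonneg_left (Real.exp_le_exp.2 ?_) (by norm_num)
          simp only [ha]; split_ifs <;> norm_num
      _ = _ := by
          rw [Finset.prod_mul_distrib, ← Real.exp_sum, ← Finset.sum_div]
          simp [hN]
  have hle : B.card * Real.exp (N / 9) ≤ 2 ^ m * Real.exp (N / 18) := by
    refine le_trans ?_ hprod
    calc (B.card : ℝ) * Real.exp (N / 9) = ∑ σ ∈ B, Real.exp (N / 9) := by simp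
      _ ≤ ∑ σ ∈ B, Real.exp (1 / 3 * ∑ i, (a i (!σ i) - a i (σ i))) := by
          refine Finset.sum_le_sum fun σ hσ => Real.exp_le_exp.2 ?_
          linarith [(hmem σ hσ).1]
      _ ≤ _ := Finset.sum_le_sum_of_subset_of_nonneg (Finset.subset_univ _)
          fun σ _ _ => (Real.exp_pos _).le
  calc (B.card : ℝ) = B.card * Real.exp (N / 9) * Real.exp (-(N / 9)) := by
        rw [mul_assoc, ← Real.exp_add]; simp
    _ ≤ 2 ^ m * Real.exp (N / 18) * Real.exp (-(N / 9)) := by gcongr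
    _ = 2 ^ m * Real.exp (-(N / 18)) := by
        rw [mul_assoc, ← Real.exp_add]; congr 2; ring
    _ ≤ _ := mul_le_mul_of_nonneg_left (Real.exp_le_exp.2 (by linarith)) (by positivity)

open Classical in
/-- The number of members of the sample `x` in `S`. -/
noncomputable def hits {ι X : Type*} [Fintype ι] (x : ι → X) (S : Set X) : ℕ :=
  (Finset.univ.filter fun i => x i ∈ S).card

theorem measurable_hits {ι X : Type*} [Fintype ι] [MeasurableSpace X] {S : Set X}
    (hS : MeasurableSet S) : Measurable fun x : ι → X => hits x S := by
  classical
  have e : (fun x : ι → X => hits x S)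
      = fun x => ∑ i, (if x i ∈ S then 1 else 0 : ℕ) := by
    ext x; rw [hits, Finset.card_filter]
  rw [e]
  exact Finset.measurable_sum _ fun i _ =>
    Measurable.ite (measurable_pi_apply i hS) measurable_const measurable_const

/-- The sample `x` hits some member of `𝒜` at most `K / 4` times, and the sample `x'` hits it at
least `K / 2` times. -/
def unbalanced {ι X : Type*} [Fintype ι] (𝒜 : Set (Set X)) (K : ℝ) :
    Set ((ι → X) × (ι → X)) :=
  {q | ∃ S ∈ 𝒜, 4 * (hits q.1 S : ℝ) ≤ K ∧ K ≤ 2 * (hits q.2 S : ℝ)}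

/-- Countability of the class enters here: the event is a countable union, and Fubini and the swap
invariance below require it to be measurable. -/
theorem measurableSet_unbalanced {ι X : Type*} [Fintype ι] [MeasurableSpace X] {𝒜 : Set (Set X)}
    (hc : 𝒜.Countable) (hm : ∀ S ∈ 𝒜, MeasurableSet S) (K : ℝ) :
    MeasurableSet (unbalanced (ι := ι) 𝒜 K) := by
  have e : unbalanced (ι := ι) 𝒜 K
      = ⋃ S ∈ 𝒜, {q | 4 * (hits q.1 S : ℝ) ≤ K ∧ K ≤ 2 * (hits q.2 S : ℝ)} := by
    ext q; simp only [unbalanced, Set.mem_ofPred_eq, Set.mem_iUnion, exists_prop]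
  rw [e]
  refine MeasurableSet.biUnion hc fun S hS => ?_
  have h : Measurable fun x : ι → X => (hits x S : ℝ) :=
    measurable_from_top.comp (measurable_hits (hm S hS))
  exact (measurableSet_le ((h.comp measurable_fst).const_mul _) measurable_const).inter
    (measurableSet_le measurable_const ((h.comp measurable_snd).const_mul _))

/-- Exchange the two members of the `i`-th pair if `σ i` is `true`. -/
def swapPairs {ι X : Type*} (σ : ι → Bool) (y : ι → X × X) : ι → X × X :=
  fun i => if σ i = true then (y i).swap else y i

theorem measurePreserving_swapPairs {ι X : Type*} [Fintype ι] [MeasurableSpace X] (D : Measure X)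
    [IsProbabilityMeasure D] (σ : ι → Bool) :
    MeasurePreserving (swapPairs σ) (Measure.pi fun _ : ι => D.prod D)
      (Measure.pi fun _ : ι => D.prod D) := by
  refine measurePreserving_pi _ _ (α := fun _ : ι => X × X) (β := fun _ : ι => X × X)
    (f := fun i (p : X × X) => if σ i = true then p.swap else p) fun i => ?_
  cases σ i
  · simpa using! MeasurePreserving.id (D.prod D)
  · simpa using Measure.measurePreserving_swap

/-- For a fixed double sample, the event depends on a member of `𝒜` only through its trace, so a
union bound over at most `G` traces applies. The swap `σ` becomes a choice of one index from each
pair `(i, false)`, `(i, true)`. -/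
theorem card_swaps_unbalanced_le {m : ℕ} {X : Type*} {𝒜 : Set (Set X)} {G : ℝ}
    (hG : ∀ x : Fin m × Bool → X, ((traces 𝒜 x).card : ℝ) ≤ G) (K : ℝ) (y : Fin m → X × X)
    [DecidablePred fun σ : Fin m → Bool =>
      ((fun i => (swapPairs σ y i).1), fun i => (swapPairs σ y i).2) ∈ unbalanced 𝒜 K] :
    ((Finset.univ.filter fun σ : Fin m → Bool =>
      ((fun i => (swapPairs σ y i).1), fun i => (swapPairs σ y i).2) ∈ unbalanced 𝒜 K).card : ℝ)
      ≤ G * (2 ^ m * Real.exp (-(K / 36))) := by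
  classical
  set x : Fin m × Bool → X := fun q => if q.2 = true then (y q.1).2 else (y q.1).1 with hx
  have h1 : ∀ (σ : Fin m → Bool) i, (swapPairs σ y i).1 = x (i, σ i) := fun σ i => by
    cases h : σ i <;> simp [swapPairs, hx, h]
  have h2 : ∀ (σ : Fin m → Bool) i, (swapPairs σ y i).2 = x (i, !σ i) := fun σ i => by
    cases h : σ i <;> simp [swapPairs, hx, h]
  have hsub : (Finset.univ.filter fun σ : Fin m → Bool =>
      ((fun i => (swapPairs σ y i).1), fun i => (swapPairs σ y i).2) ∈ unbalanced 𝒜 K)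
      ⊆ (traces 𝒜 x).biUnion fun A => Finset.univ.filter fun σ : Fin m → Bool =>
        4 * ((Finset.univ.filter fun i => (i, σ i) ∈ A).card : ℝ) ≤ K ∧
        K ≤ 2 * ((Finset.univ.filter fun i => (i, !σ i) ∈ A).card : ℝ) := by
    intro σ hσ
    obtain ⟨S, hS, ha, hb⟩ := (Finset.mem_filter.1 hσ).2
    simp only [hits, h1, h2] at ha hb
    refine Finset.mem_biUnion.2 ⟨Finset.univ.filter fun q => x q ∈ S,
      mem_traces.2 ⟨S, hS, fun q => by simp⟩, Finset.mem_filter.2 ⟨Finset.mem_univ _, ?_⟩⟩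
    simp only [Finset.mem_filter, Finset.mem_univ, true_and]
    exact ⟨by convert ha, by convert hb⟩
  calc _ ≤ ∑ A ∈ traces 𝒜 x, ((Finset.univ.filter fun σ : Fin m → Bool =>
        4 * ((Finset.univ.filter fun i => (i, σ i) ∈ A).card : ℝ) ≤ K ∧
        K ≤ 2 * ((Finset.univ.filter fun i => (i, !σ i) ∈ A).card : ℝ)).card : ℝ) := by
        exact_mod_cast (Finset.card_le_card hsub).trans Finset.card_biUnion_le
    _ ≤ ∑ A ∈ traces 𝒜 x, 2 ^ m * Real.exp (-(K / 36)) :=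
        Finset.sum_le_sum fun A _ => card_unbalanced_swaps_le A K
    _ = (traces 𝒜 x).card * (2 ^ m * Real.exp (-(K / 36))) := by
        rw [Finset.sum_const, nsmul_eq_mul]
    _ ≤ _ := mul_le_mul_of_nonneg_right (hG x) (by positivity)

/-- The law of the pairs is invariant under every swap, so the probability equals its average over
all swaps. After exchanging sum and integral, the number of bad swaps is bounded for each double
sample separately. -/
theorem prod_unbalanced_le {m : ℕ} {X : Type*} [MeasurableSpace X] (D : Measure X)
    [IsProbabilityMeasure D] {𝒜 : Set (Set X)} (hc : 𝒜.Countable)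
    (hm : ∀ S ∈ 𝒜, MeasurableSet S) {G : ℝ}
    (hG : ∀ x : Fin m × Bool → X, ((traces 𝒜 x).card : ℝ) ≤ G) (K : ℝ) :
    ((Measure.pi fun _ : Fin m => D).prod (Measure.pi fun _ : Fin m => D)) (unbalanced 𝒜 K)
      ≤ ENNReal.ofReal (G * Real.exp (-(K / 36))) := by
  classical
  have hB := measurableSet_unbalanced (ι := Fin m) hc hm K
  have hmp := measurePreserving_arrowProdEquivProdArrow X X (Fin m) (fun _ => D) (fun _ => D)
  rw [← hmp.measure_preimage hB.nullMeasurableSet]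
  set B' := (MeasurableEquiv.arrowProdEquivProdArrow X X (Fin m)) ⁻¹' unbalanced 𝒜 K with hB'
  have hB'm : MeasurableSet B' := hmp.measurable hB
  set μ := Measure.pi fun _ : Fin m => D.prod D with hμ
  have hσ : ∀ σ : Fin m → Bool, μ B' = ∫⁻ y, (swapPairs σ ⁻¹' B').indicator 1 y ∂μ := fun σ => by
    have hs := measurePreserving_swapPairs (ι := Fin m) D σ
    rw [lintegral_indicator_one (hs.measurable hB'm), hs.measure_preimage hB'm.nullMeasurableSet]
  have hsum : (2 : ℝ≥0∞) ^ m * μ B'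
      ≤ (2 : ℝ≥0∞) ^ m * ENNReal.ofReal (G * Real.exp (-(K / 36))) := by
    calc (2 : ℝ≥0∞) ^ m * μ B' = ∑ _σ : Fin m → Bool, μ B' := by simp
      _ = ∑ σ : Fin m → Bool, ∫⁻ y, (swapPairs σ ⁻¹' B').indicator 1 y ∂μ :=
          Finset.sum_congr rfl fun σ _ => hσ σ
      _ = ∫⁻ y, ∑ σ : Fin m → Bool, (swapPairs σ ⁻¹' B').indicator 1 y ∂μ := by
          rw [lintegral_finsetSum]
          exact fun σ _ => measurable_one.indicator
            ((measurePreserving_swapPairs D σ).measurable hB'm)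
      _ ≤ ∫⁻ _y, ENNReal.ofReal (G * (2 ^ m * Real.exp (-(K / 36)))) ∂μ := by
          refine lintegral_mono fun y => ?_
          have h := card_swaps_unbalanced_le hG K y
          refine le_trans (le_of_eq ?_) (ENNReal.ofReal_le_ofReal h)
          rw [ENNReal.ofReal_natCast, Finset.card_filter]
          push_cast
          refine Finset.sum_congr rfl fun σ _ => ?_
          simp only [Set.indicator, Pi.one_apply]
          rfl
      _ = _ := by
          rw [lintegral_const, measure_univ, mul_one,
            show G * (2 ^ m * Real.exp (-(K / 36))) = 2 ^ m * (G * Real.exp (-(K / 36))) by ring,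
            ENNReal.ofReal_mul (by positivity), ENNReal.ofReal_pow (by norm_num)]
          simp
  exact (ENNReal.mul_le_mul_iff_right (by simp) (by simp)).1 hsum

/-- No member of `𝒜` of mass at least `ε` is hit by less than a quarter of the expected number of
sample points, except with small probability. -/
theorem exists_sparse_le {m : ℕ} {X : Type*} [MeasurableSpace X] (D : Measure X)
    [IsProbabilityMeasure D] {𝒜 : Set (Set X)} (hc : 𝒜.Countable)
    (hm : ∀ S ∈ 𝒜, MeasurableSet S) {G : ℝ}
    (hG : ∀ x : Fin m × Bool → X, ((traces 𝒜 x).card : ℝ) ≤ G) {ε : ℝ} (hε : 6 ≤ m * ε) :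
    (Measure.pi fun _ : Fin m => D)
        {x | ∃ S ∈ 𝒜, ε ≤ D.real S ∧ 4 * (hits x S : ℝ) ≤ m * ε}
      ≤ ENNReal.ofReal (2 * G * Real.exp (-(m * ε / 36))) := by
  classical
  set P := Measure.pi fun _ : Fin m => D with hP
  set B := unbalanced (ι := Fin m) 𝒜 (m * ε) with hB
  have hBm : MeasurableSet B := measurableSet_unbalanced hc hm _
  -- The ghost sample: a heavy set that `x` hits rarely is hit at least half as often as expected by
  -- an independent second sample with probability at least one half. A sparse `x` thus has a slice
  -- of `B` of mass at least one half, which accounts for the factor 2.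
  have hsub : {x : Fin m → X | ∃ S ∈ 𝒜, ε ≤ D.real S ∧ 4 * (hits x S : ℝ) ≤ m * ε}
      ⊆ {x | (1 / 2 : ℝ≥0∞) ≤ P (Prod.mk x ⁻¹' B)} := by
    rintro x ⟨S, hS, hSε, hx⟩
    have h1 : P {x' | 2 * (hits x' S : ℝ) < m * ε} ≤ 1 / 2 := few_hits_le D hε (hm S hS) hSε
    have h2 : (1 : ℝ≥0∞) ≤ P (Prod.mk x ⁻¹' B) + 1 / 2 := by
      calc (1 : ℝ≥0∞) = P Set.univ := measure_univ.symm
        _ ≤ P (Prod.mk x ⁻¹' B ∪ {x' | 2 * (hits x' S : ℝ) < m * ε}) := by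
            refine measure_mono fun x' _ => ?_
            by_cases h : 2 * (hits x' S : ℝ) < m * ε
            · exact Or.inr h
            · exact Or.inl ⟨S, hS, hx, not_lt.1 h⟩
        _ ≤ _ := (measure_union_le _ _).trans (add_le_add le_rfl h1)
    have h3 : (1 / 2 : ℝ≥0∞) + 1 / 2 = 1 := ENNReal.add_halves 1
    have h6 : (1 / 2 : ℝ≥0∞) + 1 / 2 ≤ P (Prod.mk x ⁻¹' B) + 1 / 2 := h3.le.trans h2
    exact (ENNReal.add_le_add_iff_right (by simp)).1 h6
  have hmeas : Measurable fun x => P (Prod.mk x ⁻¹' B) := measurable_measure_prodMk_left hBm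
  have h4 := mul_meas_ge_le_lintegral (μ := P) hmeas (1 / 2)
  rw [← Measure.prod_apply hBm] at h4
  have h5 := h4.trans (prod_unbalanced_le D hc hm hG (m * ε))
  calc _ ≤ P {x | (1 / 2 : ℝ≥0∞) ≤ P (Prod.mk x ⁻¹' B)} := measure_mono hsub
    _ = 2 * (1 / 2 * P {x | (1 / 2 : ℝ≥0∞) ≤ P (Prod.mk x ⁻¹' B)}) := by
        rw [← mul_assoc, one_div, ENNReal.mul_inv_cancel (by simp) (by simp), one_mul]
    _ ≤ 2 * ENNReal.ofReal (G * Real.exp (-(m * ε / 36))) := by gcongr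
    _ = _ := by
        rw [mul_assoc, ENNReal.ofReal_mul zero_le_two, ENNReal.ofReal_ofNat]

/-! ### Learning from noisy labels -/

/-- The noisy sample `s` (instances with a flag for noise) is wrong on at least half of its
instances in `S`. -/
def Misleading {ι X : Type*} [Fintype ι] (s : ι → X × Bool) (S : Set X) : Prop :=
  hits (fun i => (s i).1) S ≤ 2 * hits s (S ×ˢ {true})

theorem hits_prod_true {ι X : Type*} [Fintype ι] (x : ι → X) (z : ι → Bool) (S : Set X)
    (A : Finset ι) (hA : ∀ i, i ∈ A ↔ x i ∈ S) :
    hits x S = A.card ∧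
      hits (fun i => (x i, z i)) (S ×ˢ {true}) = (A.filter fun i => z i = true).card := by
  classical
  constructor
  · rw [hits]; congr 1; ext i; simp [hA]
  · rw [hits]; congr 1; ext i; simp [hA]

theorem measurableSet_misleading {ι X : Type*} [Fintype ι] [MeasurableSpace X] {S : Set X}
    (hS : MeasurableSet S) : MeasurableSet {s : ι → X × Bool | Misleading s S} := by
  refine measurableSet_le ((measurable_hits hS).comp ?_)
    ((measurable_from_top (f := fun k : ℕ => 2 * k)).comp
      (measurable_hits (hS.prod (measurableSet_singleton true))))
  exact measurable_pi_iff.2 fun i => measurable_fst.comp (measurable_pi_apply i)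

/-- For fixed instances, noise that misleads on a frequently hit member of `𝒜` is unlikely. -/
theorem noise_misleading_le {ι X : Type*} [Fintype ι] (p : unitInterval) (hp : (p : ℝ) ≤ 1 / 2)
    {𝒜 : Set (Set X)} (x : ι → X) {G : ℝ} (hG : ((traces 𝒜 x).card : ℝ) ≤ G) (K : ℝ) :
    Measure.pi (fun _ : ι => bernoulliMeasure true false p)
        {z | ∃ S ∈ 𝒜, K ≤ 4 * (hits x S : ℝ) ∧ Misleading (fun i => (x i, z i)) S}
      ≤ ENNReal.ofReal (G * Real.exp (-(K * (1 - 2 * (p : ℝ)) ^ 2 / 16))) := by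
  classical
  set Q := Measure.pi (fun _ : ι => bernoulliMeasure true false p)
  have hsub : {z : ι → Bool | ∃ S ∈ 𝒜, K ≤ 4 * (hits x S : ℝ) ∧
        Misleading (fun i => (x i, z i)) S}
      ⊆ ⋃ A ∈ (traces 𝒜 x).filter fun A => K ≤ 4 * (A.card : ℝ),
        {z | A.card ≤ 2 * (A.filter fun i => z i = true).card} := by
    rintro z ⟨S, hS, hK, hz⟩
    obtain ⟨h1, h2⟩ := hits_prod_true x z S (Finset.univ.filter fun i => x i ∈ S)
      (fun i => by simp)
    rw [h1] at hK
    unfold Misleading at hz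
    rw [h2, h1] at hz
    exact Set.mem_biUnion (Finset.mem_coe.2 (Finset.mem_filter.2
      ⟨mem_traces.2 ⟨S, hS, fun i => by simp⟩, hK⟩)) hz
  refine (measure_mono hsub).trans ((measure_biUnion_finset_le _ _).trans ?_)
  calc _ ≤ ∑ A ∈ (traces 𝒜 x).filter fun A => K ≤ 4 * (A.card : ℝ),
        ENNReal.ofReal (Real.exp (-(K * (1 - 2 * (p : ℝ)) ^ 2 / 16))) := by
        refine Finset.sum_le_sum fun A hA => (bernoulli_majority_le p hp A).trans ?_
        refine ENNReal.ofReal_le_ofReal (Real.exp_le_exp.2 ?_)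
        have := (Finset.mem_filter.1 hA).2
        nlinarith [sq_nonneg (1 - 2 * (p : ℝ))]
    _ ≤ _ := by
        rw [Finset.sum_const, nsmul_eq_mul, ← ENNReal.ofReal_natCast,
          ← ENNReal.ofReal_mul (Nat.cast_nonneg _)]
        refine ENNReal.ofReal_le_ofReal (mul_le_mul_of_nonneg_right (le_trans ?_ hG)
          (Real.exp_pos _).le)
        exact_mod_cast Finset.card_filter_le _ _

/-- A sample with random classification noise rarely misleads on a set of mass at least `ε`. -/
theorem exists_misleading_le {m : ℕ} {X : Type*} [MeasurableSpace X] (D : Measure X)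
    [IsProbabilityMeasure D] (p : unitInterval) (hp : (p : ℝ) ≤ 1 / 2) {𝒜 : Set (Set X)}
    (hc : 𝒜.Countable) (hm : ∀ S ∈ 𝒜, MeasurableSet S) {G : ℝ}
    (hG : ∀ x : Fin m → X, ((traces 𝒜 x).card : ℝ) ≤ G)
    (hG2 : ∀ x : Fin m × Bool → X, ((traces 𝒜 x).card : ℝ) ≤ G) {ε : ℝ} (hε : 6 ≤ m * ε) :
    (Measure.pi fun _ : Fin m => D.prod (bernoulliMeasure true false p))
        {s | ∃ S ∈ 𝒜, ε ≤ D.real S ∧ Misleading s S}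
      ≤ ENNReal.ofReal (2 * G * Real.exp (-(m * ε / 36)))
        + ENNReal.ofReal (G * Real.exp (-(m * ε * (1 - 2 * (p : ℝ)) ^ 2 / 16))) := by
  set P := Measure.pi fun _ : Fin m => D with hP
  set Q := Measure.pi fun _ : Fin m => bernoulliMeasure true false p with hQ
  have hmp := measurePreserving_arrowProdEquivProdArrow X Bool (Fin m) (fun _ => D)
    (fun _ => bernoulliMeasure true false p)
  set e := MeasurableEquiv.arrowProdEquivProdArrow X Bool (Fin m) with he
  set U : Set ((Fin m → X) × (Fin m → Bool)) :=
    {q | ∃ S ∈ 𝒜, m * ε ≤ 4 * (hits q.1 S : ℝ) ∧ Misleading (fun i => (q.1 i, q.2 i)) S} with hU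
  have hUm : MeasurableSet U := by
    have e : U = ⋃ S ∈ 𝒜, {q | m * ε ≤ 4 * (hits q.1 S : ℝ) ∧
        Misleading (fun i => (q.1 i, q.2 i)) S} := by
      ext q; simp only [hU, Set.mem_ofPred_eq, Set.mem_iUnion, exists_prop]
    rw [e]
    refine MeasurableSet.biUnion hc fun S hS => ?_
    have h : Measurable fun x : Fin m → X => (hits x S : ℝ) :=
      measurable_from_top.comp (measurable_hits (hm S hS))
    refine (measurableSet_le measurable_const ((h.comp measurable_fst).const_mul _)).inter ?_
    have hf : Measurable fun (q : (Fin m → X) × (Fin m → Bool)) i => (q.1 i, q.2 i) :=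
      measurable_pi_iff.2 fun i => ((measurable_pi_apply i).comp measurable_fst).prodMk
        ((measurable_pi_apply i).comp measurable_snd)
    exact hf (measurableSet_misleading (hm S hS))
  have hPQ : (P.prod Q) U
      ≤ ENNReal.ofReal (G * Real.exp (-(m * ε * (1 - 2 * (p : ℝ)) ^ 2 / 16))) := by
    rw [Measure.prod_apply hUm]
    calc _ ≤ ∫⁻ _x, ENNReal.ofReal (G * Real.exp (-(m * ε * (1 - 2 * (p : ℝ)) ^ 2 / 16))) ∂P :=
          lintegral_mono fun x => noise_misleading_le p hp x (hG x) _
      _ = _ := by rw [lintegral_const, measure_univ, mul_one]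
  have hsparse := exists_sparse_le D hc hm hG2 hε
  have hfst : MeasurePreserving (fun s : Fin m → X × Bool => fun i => (s i).1)
      (Measure.pi fun _ : Fin m => D.prod (bernoulliMeasure true false p)) P :=
    measurePreserving_pi (fun _ : Fin m => D.prod (bernoulliMeasure true false p))
      (fun _ => D) fun _ => measurePreserving_fst
  -- A quarter of the expected number of hits is the dividing line: below it the instances are to
  -- blame, above it the noise.
  have hsub : {s : Fin m → X × Bool | ∃ S ∈ 𝒜, ε ≤ D.real S ∧ Misleading s S}
      ⊆ (fun s : Fin m → X × Bool => fun i => (s i).1) ⁻¹'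
          {x | ∃ S ∈ 𝒜, ε ≤ D.real S ∧ 4 * (hits x S : ℝ) ≤ m * ε} ∪ e ⁻¹' U := by
    rintro s ⟨S, hS, hSε, hs⟩
    rcases le_total (4 * (hits (fun i => (s i).1) S : ℝ)) (m * ε) with h | h
    · exact Or.inl ⟨S, hS, hSε, h⟩
    · exact Or.inr ⟨S, hS, h, hs⟩
  refine (measure_mono hsub).trans ((measure_union_le _ _).trans (add_le_add ?_ ?_))
  · exact (hfst.measure_preimage_le _).trans hsparse
  · rw [hmp.measure_preimage hUm.nullMeasurableSet]
    exact hPQ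

/-! ### From a countable dense subclass to the whole concept class -/

theorem hits_congr {ι X : Type*} [Fintype ι] {x : ι → X} {S S' : Set X}
    (h : ∀ i, x i ∈ S ↔ x i ∈ S') : hits x S = hits x S' := by
  classical
  simp [hits, h]

/-- A hypothesis that fits the sample better than the target can be replaced by one from a
sequentially dense subclass. -/
theorem exists_dense_misleading {ι X : Type*} [Fintype ι] [MeasurableSpace X] {D : Measure X}
    [IsProbabilityMeasure D] {𝒞 𝒞₀ : Set (X → Bool)} (hmeas : ∀ h ∈ 𝒞, Measurable h)
    (hsub : 𝒞₀ ⊆ 𝒞)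
    (hdense : ∀ h ∈ 𝒞, ∃ u : ℕ → X → Bool, (∀ k, u k ∈ 𝒞₀) ∧
      ∀ x, ∀ᶠ k in atTop, u k x = h x)
    {c : X → Bool} (hc : c ∈ 𝒞) {ε : ℝ} (hε : 0 < ε) {s : ι → X × Bool} {h : X → Bool}
    (hh : h ∈ 𝒞) (hD : ε ≤ D.real {x | h x ≠ c x}) (hs : Misleading s {x | h x ≠ c x}) :
    ∃ S ∈ errorSets 𝒞₀ c, ε / 2 ≤ D.real S ∧ Misleading s S := by
  obtain ⟨u, hu, hlim⟩ := hdense h hh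
  have hset : ∀ g ∈ 𝒞, MeasurableSet {x | g x ≠ c x} := fun g hg =>
    (measurableSet_eq_fun (hmeas g hg) (hmeas c hc)).compl
  have hev : ∀ᶠ k in atTop, ∀ i, u k (s i).1 = h (s i).1 := eventually_all.2 fun i => hlim _
  have htend : Tendsto (fun k => D {x | u k x ≠ c x}) atTop (nhds (D {x | h x ≠ c x})) :=
    tendsto_measure_of_tendsto_indicator_of_isFiniteMeasure atTop D
      (fun k => hset _ (hsub (hu k))) fun x => (hlim x).mono fun k hk => by simp [hk]
  have htend' : Tendsto (fun k => D.real {x | u k x ≠ c x}) atTop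
      (nhds (D.real {x | h x ≠ c x})) :=
    (ENNReal.tendsto_toReal (measure_ne_top _ _)).comp htend
  -- The approximants eventually agree with `h` on the finite sample, so misleading is inherited
  -- exactly. Their errors only converge, which costs a factor below 1; one half is taken.
  obtain ⟨k, hk1, hk2⟩ := (hev.and (htend'.eventually_const_le
    (show ε / 2 < D.real {x | h x ≠ c x} by linarith))).exists
  refine ⟨_, ⟨u k, hu k, rfl⟩, hk2, ?_⟩
  unfold Misleading at hs ⊢
  rw [hits_congr (S' := {x | h x ≠ c x}) fun i => by simp [hk1],
    hits_congr (S' := {x | h x ≠ c x} ×ˢ {true}) fun i => by simp [hk1]]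
  exact hs

/-- No hypothesis of error at least `ε` fits a noisy sample as well as the target, except with
small probability. -/
theorem vc_misleading_le {m d : ℕ} {X : Type*} [MeasurableSpace X] (D : Measure X)
    [IsProbabilityMeasure D] (p : unitInterval) (hp : (p : ℝ) ≤ 1 / 2) {𝒞 : Set (X → Bool)}
    (hmeas : ∀ h ∈ 𝒞, Measurable h) (hsep : UniversallySeparable 𝒞) (hd : vcDimension 𝒞 = d)
    (hd1 : 1 ≤ d) (hdm : d ≤ m) {c : X → Bool} (hc : c ∈ 𝒞) {ε : ℝ} (hε : 12 ≤ m * ε) :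
    (Measure.pi fun _ : Fin m => D.prod (bernoulliMeasure true false p))
        {s | ∃ h ∈ 𝒞, ε ≤ D.real {x | h x ≠ c x} ∧ Misleading s {x | h x ≠ c x}}
      ≤ ENNReal.ofReal (3 * (Real.exp 1 * (2 * m) / d) ^ d
          * Real.exp (-(m * ε * (1 - 2 * (p : ℝ)) ^ 2 / 72))) := by
  obtain ⟨𝒞₀, hsub, hcount, hdense⟩ := hsep
  have hε0 : 0 < ε := by
    by_contra h
    have : (m : ℝ) * ε ≤ 0 := mul_nonpos_of_nonneg_of_nonpos (Nat.cast_nonneg _) (not_lt.1 h)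
    linarith
  set G : ℝ := (Real.exp 1 * (2 * m) / d) ^ d with hGdef
  have hG0 : 0 ≤ G := by positivity
  have hmono : errorSets 𝒞₀ c ⊆ errorSets 𝒞 c := Set.image_mono hsub
  have hG2 : ∀ x : Fin m × Bool → X, ((traces (errorSets 𝒞₀ c) x).card : ℝ) ≤ G := fun x => by
    have h1 := card_traces_le (c := c) hd hd1 (by simp; omega) x
    have h2 : ((traces (errorSets 𝒞₀ c) x).card : ℝ) ≤ (traces (errorSets 𝒞 c) x).card := by
      exact_mod_cast Finset.card_le_card (traces_mono hmono x)
    refine h2.trans (h1.trans (le_of_eq ?_))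
    simp [hGdef, mul_comm]
  have hG1 : ∀ x : Fin m → X, ((traces (errorSets 𝒞₀ c) x).card : ℝ) ≤ G := fun x => by
    have h1 := card_traces_le (c := c) hd hd1 (by simpa using hdm) x
    have h2 : ((traces (errorSets 𝒞₀ c) x).card : ℝ) ≤ (traces (errorSets 𝒞 c) x).card := by
      exact_mod_cast Finset.card_le_card (traces_mono hmono x)
    refine h2.trans (h1.trans ?_)
    rw [hGdef, Fintype.card_fin]
    gcongr
    linarith [(Nat.cast_nonneg m : (0 : ℝ) ≤ m)]
  have hA : ∀ S ∈ errorSets 𝒞₀ c, MeasurableSet S := by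
    rintro _ ⟨g, hg, rfl⟩
    exact (measurableSet_eq_fun (hmeas g (hsub hg)) (hmeas c hc)).compl
  have hmain := exists_misleading_le (m := m) D p hp (hcount.image _) hA hG1 hG2 (ε := ε / 2)
    (by linarith)
  refine (measure_mono ?_).trans (hmain.trans ?_)
  · rintro s ⟨h, hh, hD, hs⟩
    exact exists_dense_misleading hmeas hsub hdense hc hε0 hh hD hs
  · rw [← ENNReal.ofReal_add (by positivity) (by positivity)]
    refine ENNReal.ofReal_le_ofReal ?_
    have hγ0 : 0 ≤ 1 - 2 * (p : ℝ) := by linarith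
    have hγ1 : (1 - 2 * (p : ℝ)) ^ 2 ≤ 1 := by nlinarith [p.2.1]
    have hmε : 0 ≤ m * ε := by linarith
    -- Halving `ε` turns the exponents `1 / 36` and `1 / 16` into `1 / 72` and `1 / 32`; the squared
    -- margin is at most 1, so both are covered by the common exponent with `1 / 72`.
    have e1 : Real.exp (-(m * (ε / 2) / 36))
        ≤ Real.exp (-(m * ε * (1 - 2 * (p : ℝ)) ^ 2 / 72)) := Real.exp_le_exp.2 (by nlinarith)
    have e2 : Real.exp (-(m * (ε / 2) * (1 - 2 * (p : ℝ)) ^ 2 / 16))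
        ≤ Real.exp (-(m * ε * (1 - 2 * (p : ℝ)) ^ 2 / 72)) :=
      Real.exp_le_exp.2 (by nlinarith [mul_nonneg hmε (sq_nonneg (1 - 2 * (p : ℝ)))])
    nlinarith [mul_le_mul_of_nonneg_left e1 hG0, mul_le_mul_of_nonneg_left e2 hG0]

/-! ### Values and costs of instrumented computations -/

namespace Run

variable {α β : Type*}

theorem forAll_val (f : α → Run β) (l : List α) : (forAll f l).val = l.map fun a => (f a).val := by
  induction l with
  | nil => rfl
  | cons a l ih => simp [forAll, bind, pure, ih]

theorem forAll_tasks (f : α → Run β) (l : List α) :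
    (forAll f l).tasks = (l.map fun a => (f a).tasks).sum := by
  induction l with
  | nil => rfl
  | cons a l ih => simp [forAll, bind, pure, ih]

theorem forAll_steps (f : α → Run β) (l : List α) :
    (forAll f l).steps = (l.map fun a => (f a).steps).sum := by
  induction l with
  | nil => rfl
  | cons a l ih => simp [forAll, bind, pure, ih]

theorem tally_val (q : α → Run Bool) (l : List α) :
    (tally q l).val = l.countP fun a => (q a).val := by
  induction l with
  | nil => rfl
  | cons a l ih =>
    cases h : (q a).val <;> simp [tally, bind, step, ih, h]

theorem tally_tasks (q : α → Run Bool) (l : List α) :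
    (tally q l).tasks = (l.map fun a => (q a).tasks).sum := by
  induction l with
  | nil => rfl
  | cons a l ih => simp [tally, bind, step, ih]

theorem tally_steps (q : α → Run Bool) (l : List α) :
    (tally q l).steps = (l.map fun a => (q a).steps + 1).sum := by
  induction l with
  | nil => rfl
  | cons a l ih => simp [tally, bind, step, ih]; omega

theorem argmax_tasks (score : α → Run ℕ) (best : α × ℕ) (l : List α) :
    (argmax score best l).tasks = (l.map fun a => (score a).tasks).sum := by
  induction l generalizing best with
  | nil => rfl
  | cons a l ih => simp [argmax, bind, step, ih]

theorem argmax_steps (score : α → Run ℕ) (best : α × ℕ) (l : List α) :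
    (argmax score best l).steps = (l.map fun a => (score a).steps + 1).sum := by
  induction l generalizing best with
  | nil => rfl
  | cons a l ih => simp [argmax, bind, step, ih]; omega

/-- The invariant of the scan is that the recorded score of the champion does not exceed its true
score. An inequality is enough, so the start `(0, 0)`, with a score that was never computed, is
admissible. -/
theorem le_score_argmax (score : α → Run ℕ) (best : α × ℕ) (l : List α)
    (hbest : best.2 ≤ (score best.1).val) :
    best.2 ≤ (score (argmax score best l).val).val ∧
      ∀ a ∈ l, (score a).val ≤ (score (argmax score best l).val).val := by
  induction l generalizing best with
  | nil => exact ⟨hbest, by simp⟩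
  | cons a l ih =>
    have e : (argmax score best (a :: l)).val
        = (argmax score (if best.2 < (score a).val then (a, (score a).val) else best) l).val := rfl
    rw [e]
    split_ifs with h
    · obtain ⟨h1, h2⟩ := ih (a, (score a).val) le_rfl
      refine ⟨h.le.trans h1, fun b hb => ?_⟩
      rcases List.mem_cons.1 hb with rfl | hb
      · exact h1
      · exact h2 b hb
    · obtain ⟨h1, h2⟩ := ih best hbest
      refine ⟨h1, fun b hb => ?_⟩
      rcases List.mem_cons.1 hb with rfl | hb
      · exact (not_lt.1 h).trans h1
      · exact h2 b hb

end Run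

/-! ### The three steps on an outcome -/

theorem countP_finRange {n : ℕ} (p : Fin n → Bool) :
    (List.finRange n).countP p = (Finset.univ.filter fun i => p i = true).card := by
  rw [List.countP_eq_length_filter, Fin.univ_def]
  simp [Finset.filter, Finset.card]

theorem card_filter_eq_sum_toNat {ι : Type*} [Fintype ι] (p : ι → Bool) :
    (Finset.univ.filter fun i => p i = true).card = ∑ i, (p i).toNat := by
  rw [Finset.card_filter]
  exact Finset.sum_congr rfl fun i _ => by cases p i <;> rfl

theorem hits_eq_sum_toNat {ι X : Type*} [Fintype ι] {x : ι → X} {S : Set X} (p : ι → Bool)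
    (hp : ∀ i, x i ∈ S ↔ p i = true) : hits x S = ∑ i, (p i).toNat := by
  classical
  rw [← card_filter_eq_sum_toNat, hits]
  exact congrArg Finset.card (by ext i; simp [hp])

section

variable {X : Type*} {n T L m : ℕ} (c : X → Bool)

theorem groundTruth_tasks (g : Fin T → Item X n) (v : Fin T → Fin L → Fin n) :
    (groundTruth (askWorker c) g v).tasks = T * L := by
  simp [groundTruth, Run.forAll_tasks, Run.bind, Run.tally_tasks, Run.step, askWorker]

theorem groundTruth_steps (g : Fin T → Item X n) (v : Fin T → Fin L → Fin n) :
    (groundTruth (askWorker c) g v).steps = T * (2 * L + 1) := by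
  simp [groundTruth, Run.forAll_steps, Run.bind, Run.tally_steps, Run.step, askWorker, mul_comm]

theorem groundTruth_val (g : Fin T → Item X n) (v : Fin T → Fin L → Fin n)
    (h : ∀ t, 2 * (Finset.univ.filter fun j => (g t).2 (v t j) = true).card < L) :
    (groundTruth (askWorker c) g v).val
      = (List.finRange T).map fun t => (g t, c (g t).1) := by
  rw [groundTruth, Run.forAll_val]
  refine List.map_congr_left fun t _ => ?_
  simp only [Run.bind, Run.step, Run.tally_val, askWorker, countP_finRange]
  congr 1
  have ht := h t
  have hadd := Finset.card_filter_add_card_filter_not (s := (Finset.univ : Finset (Fin L)))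
    (fun j => (g t).2 (v t j) = true)
  rw [Finset.card_univ, Fintype.card_fin] at hadd
  cases hc : c (g t).1
  · simp only [Bool.false_xor]
    exact decide_eq_false (by omega)
  · simp only [Bool.true_xor, Bool.not_eq_true'] at hadd ⊢
    simp only [Bool.not_eq_true] at hadd
    exact decide_eq_true (by omega)

theorem train_tasks (erm : List (X × Bool) → X → Bool) (w : Fin n) (s : Fin m → Item X n) :
    (train (askWorker c) Prod.fst erm w s).tasks = m := by
  simp [train, Run.forAll_tasks, Run.bind, Run.step, askWorker]

theorem train_steps (erm : List (X × Bool) → X → Bool) (w : Fin n) (s : Fin m → Item X n) :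
    (train (askWorker c) Prod.fst erm w s).steps = 2 * m + 1 := by
  simp [train, Run.forAll_steps, Run.bind, Run.step, askWorker, mul_comm]

theorem train_val (erm : List (X × Bool) → X → Bool) (w : Fin n) (s : Fin m → Item X n) :
    (train (askWorker c) Prod.fst erm w s).val
      = erm ((List.finRange m).map fun j => ((s j).1, xor (c (s j).1) ((s j).2 w))) := by
  simp [train, Run.forAll_val, Run.bind, Run.step, askWorker]

variable [NeZero n]

theorem bestWorker_tasks (G : List (Item X n × Bool)) :
    (bestWorker (askWorker c) G).tasks = n * G.length := by
  simp [bestWorker, Run.argmax_tasks, Run.tally_tasks, Run.bind, Run.step, askWorker]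

theorem bestWorker_steps (G : List (Item X n × Bool)) :
    (bestWorker (askWorker c) G).steps = n * (3 * G.length + 1) := by
  simp [bestWorker, Run.argmax_steps, Run.tally_steps, Run.bind, Run.step, askWorker, mul_comm]

/-- The identified worker errs least often on correctly labelled ground-truth points. -/
theorem bestWorker_val (g : Fin T → Item X n) (w : Fin n) :
    (Finset.univ.filter fun t => (g t).2 (bestWorker (askWorker c)
        ((List.finRange T).map fun t => (g t, c (g t).1))).val = true).card
      ≤ (Finset.univ.filter fun t => (g t).2 w = true).card := by
  set G := (List.finRange T).map fun t => (g t, c (g t).1) with hG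
  set score : Fin n → Run ℕ := fun w =>
    Run.tally (fun z => (askWorker c z.1 w).bind fun b => Run.step (b == z.2)) G with hscore
  have hval : ∀ w, (score w).val + (Finset.univ.filter fun t => (g t).2 w = true).card = T := by
    intro w
    have h1 : (score w).val = (Finset.univ.filter fun t => ¬ (g t).2 w = true).card := by
      rw [hscore]
      simp only [Run.tally_val, hG, List.countP_map]
      rw [countP_finRange]
      -- Agreement with a correct label means exactly that the noise flag is off, so the target
      -- drops out of the score.
      have key : ∀ a b : Bool, (xor a b == a) = true ↔ ¬ b = true := by decide
      exact congrArg Finset.card (Finset.filter_congr fun t _ => key _ _)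
    rw [h1, add_comm, Finset.card_filter_add_card_filter_not, Finset.card_univ, Fintype.card_fin]
  have := (Run.le_score_argmax score (0, 0) (List.finRange n) (Nat.zero_le _)).2 w
    (List.mem_finRange w)
  have h1 := hval w
  have h2 := hval (Run.argmax score (0, 0) (List.finRange n)).val
  change (Finset.univ.filter fun t => (g t).2 (Run.argmax score (0, 0) (List.finRange n)).val
    = true).card ≤ _
  omega

theorem crowdRun_tasks (erm : List (X × Bool) → X → Bool) (ω : Outcome X n T L m) :
    (crowdRun c erm ω).tasks = T * L + n * T + m := by
  have hlen : (groundTruth (askWorker c) ω.1.1 ω.1.2).val.length = T := by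
    simp [groundTruth, Run.forAll_val]
  simp only [crowdRun, threeStep, Run.bind, Run.pure, groundTruth_tasks, bestWorker_tasks,
    train_tasks, hlen]
  omega

theorem crowdRun_steps (erm : List (X × Bool) → X → Bool) (ω : Outcome X n T L m) :
    (crowdRun c erm ω).steps = T * (2 * L + 1) + n * (3 * T + 1) + (2 * m + 1) := by
  have hlen : (groundTruth (askWorker c) ω.1.1 ω.1.2).val.length = T := by
    simp [groundTruth, Run.forAll_val]
  simp only [crowdRun, threeStep, Run.bind, Run.pure, groundTruth_steps, bestWorker_steps,
    train_steps, hlen]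
  omega

theorem crowdRun_worker (erm : List (X × Bool) → X → Bool) (ω : Outcome X n T L m)
    (h : ∀ t, 2 * (Finset.univ.filter fun j => (ω.1.1 t).2 (ω.1.2 t j) = true).card < L)
    (w : Fin n) :
    (Finset.univ.filter fun t => (ω.1.1 t).2 (crowdRun c erm ω).val.1 = true).card
      ≤ (Finset.univ.filter fun t => (ω.1.1 t).2 w = true).card := by
  have e : (crowdRun c erm ω).val.1
      = (bestWorker (askWorker c) (groundTruth (askWorker c) ω.1.1 ω.1.2).val).val := rfl
  rw [e, groundTruth_val c _ _ h]
  exact bestWorker_val c ω.1.1 w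

/-- The learned hypothesis fits the labels of the identified worker at least as well as the
target. -/
theorem crowdRun_hypothesis {𝒞 : Set (X → Bool)} {erm : List (X × Bool) → X → Bool}
    (herm : IsERM 𝒞 erm) (hc : c ∈ 𝒞) (ω : Outcome X n T L m) :
    (crowdRun c erm ω).val.2 ∈ 𝒞 ∧
      Misleading (fun j => ((ω.2 j).1, (ω.2 j).2 (crowdRun c erm ω).val.1))
        {x | (crowdRun c erm ω).val.2 x ≠ c x} := by
  set w := (crowdRun c erm ω).val.1 with hw
  set S := (List.finRange m).map fun j => ((ω.2 j).1, xor (c (ω.2 j).1) ((ω.2 j).2 w)) with hS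
  have e : (crowdRun c erm ω).val.2 = erm S := train_val c erm w ω.2
  rw [e]
  refine ⟨(herm S).1, ?_⟩
  have hle := (herm S).2 c hc
  set h := erm S
  have hdis : ∀ f : X → Bool, disagreements f S
      = ∑ j, (f (ω.2 j).1 != xor (c (ω.2 j).1) ((ω.2 j).2 w)).toNat := by
    intro f
    rw [disagreements, hS, List.countP_map, countP_finRange, card_filter_eq_sum_toNat]
    rfl
  rw [hdis, hdis] at hle
  rw [Misleading, hits_eq_sum_toNat (fun j => h (ω.2 j).1 != c (ω.2 j).1) (by simp),
    hits_eq_sum_toNat (fun j => (h (ω.2 j).1 != c (ω.2 j).1) && (ω.2 j).2 w) (by simp),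
    Finset.mul_sum]
  -- Where hypothesis and target differ, exactly one of them disagrees with the noisy label, and it
  -- is the target precisely when the flag `z` is on. Summed over the sample and combined with the
  -- minimality of the empirical risk, this is `Misleading`.
  have key : ∀ a b z : Bool, (a != b).toNat + (b != xor b z).toNat
      = 2 * ((a != b) && z).toNat + (a != xor b z).toNat := by decide
  have := Finset.sum_congr (rfl : (Finset.univ : Finset (Fin m)) = _) fun j _ =>
    key (h (ω.2 j).1) (c (ω.2 j).1) ((ω.2 j).2 w)
  rw [Finset.sum_add_distrib, Finset.sum_add_distrib] at this
  omega

end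

/-! ### Failure events of the algorithm -/

/-- If the votes are right and the empirical error rates are accurate, then the identified worker
is nearly optimal. -/
theorem isOptimalWorker_of_accurate {X : Type*} {n T L m : ℕ} (η : Fin n → unitInterval)
    [NeZero n] (c : X → Bool) (erm : List (X × Bool) → X → Bool)
    (hT : 0 < T) {Δ : ℝ} (ω : Outcome X n T L m)
    (hvote : ∀ t, 2 * (Finset.univ.filter fun j => (ω.1.1 t).2 (ω.1.2 t j) = true).card < L)
    (hdev : ∀ w, |((Finset.univ.filter fun t => (ω.1.1 t).2 w = true).card : ℝ) - T * η w|
      ≤ T * (Δ / 2)) :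
    IsOptimalWorker η Δ (crowdRun c erm ω).val.1 := by
  obtain ⟨w, hw⟩ := exists_eq_ciInf_of_finite (f := fun w => (η w : ℝ))
  have h1 := crowdRun_worker c erm ω hvote w
  have h1' : ((Finset.univ.filter fun t => (ω.1.1 t).2 (crowdRun c erm ω).val.1 = true).card : ℝ)
      ≤ (Finset.univ.filter fun t => (ω.1.1 t).2 w = true).card := by exact_mod_cast h1
  have h2 := (abs_le.1 (hdev w)).2
  have h3 := (abs_le.1 (hdev (crowdRun c erm ω).val.1)).1
  have hT' : (0 : ℝ) < T := by exact_mod_cast hT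
  rw [IsOptimalWorker, bestRate, ← hw]
  -- The identified worker errs no more often on the sample than the best one; each count is off by
  -- at most `T * (Δ / 2)`, so the rates differ by at most `Δ`.
  refine le_of_mul_le_mul_left ?_ hT'
  linarith

section

variable {X : Type*} [MeasurableSpace X] {n T L m : ℕ} (D : Measure X) [IsProbabilityMeasure D]
  (η : Fin n → unitInterval)

instance isProbabilityMeasure_itemLaw : IsProbabilityMeasure (itemLaw D η) := by
  unfold itemLaw; infer_instance

/-- This is where the crowd must be large enough: without an injection the uniform law would be the
zero measure. -/
theorem isProbabilityMeasure_uniformOn_injective (hL : L ≤ n) :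
    IsProbabilityMeasure (uniformOn {v : Fin L → Fin n | Function.Injective v}) :=
  isProbabilityMeasure_uniformOn (Set.toFinite _) ⟨Fin.castLE hL, Fin.castLE_injective hL⟩

theorem measurePreserving_itemLaw_noise :
    MeasurePreserving (Prod.snd : Item X n → _) (itemLaw D η)
      (Measure.pi fun w => bernoulliMeasure true false (η w)) :=
  measurePreserving_snd

theorem measurePreserving_itemLaw_worker (w : Fin n) :
    MeasurePreserving (fun z : Item X n => (z.1, z.2 w)) (itemLaw D η)
      (D.prod (bernoulliMeasure true false (η w))) :=
  (MeasurePreserving.id D).prod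
    (measurePreserving_eval (fun w => bernoulliMeasure true false (η w)) w)

/-- The majority vote on a ground-truth point is rarely wrong. -/
theorem outcomeLaw_vote_le (hL : L ≤ n) (hn : 0 < n) (havg : avgRate η ≤ 1 / 2) (t : Fin T) :
    outcomeLaw D η T L m
        {ω | L ≤ 2 * (Finset.univ.filter fun j => (ω.1.1 t).2 (ω.1.2 t j) = true).card}
      ≤ ENNReal.ofReal (Real.exp (-(L * (1 - 2 * avgRate η) ^ 2 / 4))) := by
  have := isProbabilityMeasure_uniformOn_injective hL
  have h1 : MeasurePreserving (fun g : Fin T → Item X n => (g t).2)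
      (Measure.pi fun _ : Fin T => itemLaw D η)
      (Measure.pi fun w => bernoulliMeasure true false (η w)) :=
    (measurePreserving_itemLaw_noise D η).comp (measurePreserving_eval (fun _ => itemLaw D η) t)
  have h2 : MeasurePreserving (fun ω : Outcome X n T L m => ((ω.1.1 t).2, ω.1.2 t))
      (outcomeLaw D η T L m)
      ((Measure.pi fun w => bernoulliMeasure true false (η w)).prod
        (uniformOn {v : Fin L → Fin n | Function.Injective v})) :=
    (h1.prod (measurePreserving_eval
      (fun _ : Fin T => uniformOn {v : Fin L → Fin n | Function.Injective v}) t)).comp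
      measurePreserving_fst
  exact (h2.measure_preimage_le _).trans (crowd_majority_le hL hn η havg)

/-- The empirical error rate of a worker is rarely far from the noise rate. -/
theorem outcomeLaw_deviation_le (hL : L ≤ n) (w : Fin n) {a : ℝ} (ha0 : 0 ≤ a) (ha : a ≤ 1) :
    outcomeLaw D η T L m
        {ω | T * (a / 2)
          < |((Finset.univ.filter fun t => (ω.1.1 t).2 w = true).card : ℝ) - T * η w|}
      ≤ 2 * ENNReal.ofReal (Real.exp (-(T * a ^ 2 / 4))) := by
  have := isProbabilityMeasure_uniformOn_injective hL
  have h1 : MeasurePreserving (fun g : Fin T → Item X n => fun t => (g t).2 w)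
      (Measure.pi fun _ : Fin T => itemLaw D η)
      (Measure.pi fun _ : Fin T => bernoulliMeasure true false (η w)) :=
    measurePreserving_pi (fun _ : Fin T => itemLaw D η)
      (fun _ : Fin T => bernoulliMeasure true false (η w)) fun _ =>
        (measurePreserving_eval (fun w => bernoulliMeasure true false (η w)) w).comp
          (measurePreserving_itemLaw_noise D η)
  have h2 : MeasurePreserving (fun ω : Outcome X n T L m => fun t => (ω.1.1 t).2 w)
      (outcomeLaw D η T L m) (Measure.pi fun _ : Fin T => bernoulliMeasure true false (η w)) :=
    (h1.comp measurePreserving_fst).comp measurePreserving_fst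
  exact (h2.measure_preimage_le _).trans (bernoulli_deviation_le (η w) ha0 ha)

/-- To a fixed worker the training data are an ordinary sample with classification noise at that
worker's rate, to which the learning bound applies. -/
theorem measurePreserving_training (hL : L ≤ n) (w : Fin n) :
    MeasurePreserving (fun ω : Outcome X n T L m => fun j => ((ω.2 j).1, (ω.2 j).2 w))
      (outcomeLaw D η T L m)
      (Measure.pi fun _ : Fin m => D.prod (bernoulliMeasure true false (η w))) := by
  have := isProbabilityMeasure_uniformOn_injective hL
  exact (measurePreserving_pi (fun _ : Fin m => itemLaw D η)
      (fun _ : Fin m => D.prod (bernoulliMeasure true false (η w))) fun _ =>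
        measurePreserving_itemLaw_worker D η w).comp measurePreserving_snd

/-- The failure probability of the algorithm, in terms of the failure probabilities of its three
steps. -/
theorem outcomeLaw_failure_le [NeZero n] (hL : L ≤ n) (hT : 0 < T) (havg : avgRate η ≤ 1 / 2)
    {Δ : ℝ} (hΔ0 : 0 ≤ Δ) (hΔ1 : Δ ≤ 1) {𝒞 : Set (X → Bool)} {erm : List (X × Bool) → X → Bool}
    (herm : IsERM 𝒞 erm) {c : X → Bool} (hc : c ∈ 𝒞) {ε : ℝ} {b : ℝ≥0∞}
    (hlearn : ∀ w, IsOptimalWorker η Δ w →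
      (Measure.pi fun _ : Fin m => D.prod (bernoulliMeasure true false (η w)))
        {s | ∃ h ∈ 𝒞, ε ≤ D.real {x | h x ≠ c x} ∧ Misleading s {x | h x ≠ c x}} ≤ b) :
    outcomeLaw D η T L m {ω | ¬ (IsOptimalWorker η Δ (crowdRun c erm ω).val.1 ∧
        D.real {x | (crowdRun c erm ω).val.2 x ≠ c x} < ε)}
      ≤ T * ENNReal.ofReal (Real.exp (-(L * (1 - 2 * avgRate η) ^ 2 / 4)))
        + n * (2 * ENNReal.ofReal (Real.exp (-(T * Δ ^ 2 / 4)))) + n * b := by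
  classical
  set μ := outcomeLaw D η T L m
  set V : Fin T → Set (Outcome X n T L m) := fun t =>
    {ω | L ≤ 2 * (Finset.univ.filter fun j => (ω.1.1 t).2 (ω.1.2 t j) = true).card} with hV
  set W : Fin n → Set (Outcome X n T L m) := fun w => {ω | T * (Δ / 2)
      < |((Finset.univ.filter fun t => (ω.1.1 t).2 w = true).card : ℝ) - T * η w|} with hW
  -- The worker who labels the training sample is random. A union over all optimal workers replaces
  -- conditioning on the first two steps; the resulting factor `n` costs only a logarithm in the
  -- sample size.
  set U : Fin n → Set (Outcome X n T L m) := fun w => {ω | IsOptimalWorker η Δ w ∧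
    ∃ h ∈ 𝒞, ε ≤ D.real {x | h x ≠ c x} ∧
      Misleading (fun j => ((ω.2 j).1, (ω.2 j).2 w)) {x | h x ≠ c x}} with hU
  have hsub : {ω : Outcome X n T L m | ¬ (IsOptimalWorker η Δ (crowdRun c erm ω).val.1 ∧
        D.real {x | (crowdRun c erm ω).val.2 x ≠ c x} < ε)}
      ⊆ ((⋃ t, V t) ∪ ⋃ w, W w) ∪ ⋃ w, U w := by
    intro ω hω
    by_contra hnot
    simp only [Set.mem_union, Set.mem_iUnion, not_or, not_exists] at hnot
    obtain ⟨⟨hv, hw⟩, hu⟩ := hnot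
    have hopt : IsOptimalWorker η Δ (crowdRun c erm ω).val.1 :=
      isOptimalWorker_of_accurate η c erm hT ω (fun t => not_le.1 (hv t)) fun w => not_lt.1 (hw w)
    obtain ⟨h1, h2⟩ := crowdRun_hypothesis c herm hc ω
    exact hω ⟨hopt, not_le.1 fun h3 => hu _ ⟨hopt, _, h1, h3, h2⟩⟩
  refine (measure_mono hsub).trans ((measure_union_le _ _).trans
    (add_le_add ((measure_union_le _ _).trans (add_le_add ?_ ?_)) ?_))
  · refine (measure_iUnion_fintype_le μ V).trans ?_
    refine (Finset.sum_le_sum fun t _ => outcomeLaw_vote_le D η hL (NeZero.pos n) havg t).trans ?_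
    simp
  · refine (measure_iUnion_fintype_le μ W).trans ?_
    refine (Finset.sum_le_sum fun w _ => outcomeLaw_deviation_le D η hL w hΔ0 hΔ1).trans ?_
    simp
  · refine (measure_iUnion_fintype_le μ U).trans ?_
    refine (Finset.sum_le_sum (g := fun _ => b) fun w _ => ?_).trans (by simp)
    by_cases hw : IsOptimalWorker η Δ w
    · refine le_trans (measure_mono fun ω hω => ?_)
        (((measurePreserving_training D η hL w).measure_preimage_le _).trans (hlearn w hw))
      exact hω.2
    · have : U w = ∅ := Set.eq_empty_iff_forall_notMem.2 fun ω hω => hw hω.1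
      rw [this]; simp

end

/-! ### The choice of the parameters -/

/-- A union bound over `N` events whose exponents exceed `log (N / δ)` by a constant factor. -/
theorem mul_exp_neg_le {c₀ N δ x : ℝ} (hc₀ : 0 < c₀) (hN : 1 ≤ N) (hδ : 0 < δ)
    (hδc : c₀ ≤ Real.log (1 / δ)) (hx : (4 + 8 / c₀) * Real.log (N / δ) ≤ x) :
    N * Real.exp (-(x / 4)) ≤ δ / 6 := by
  have hNpos : 0 < N := by linarith
  have hlog : c₀ ≤ Real.log (N / δ) := hδc.trans (Real.log_le_log (by positivity) (by gcongr))
  -- The part 4 of the constant cancels `N / δ`. The part `8 / c₀` provides the additional 2,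
  -- because the logarithm is at least `c₀`, and `exp (-2) ≤ 1 / 6`.
  have h1 : -(x / 4) ≤ -Real.log (N / δ) - 2 := by
    have : 2 ≤ 2 / c₀ * Real.log (N / δ) := by
      rw [div_mul_eq_mul_div, le_div_iff₀ hc₀]; linarith
    have e : (4 + 8 / c₀) * Real.log (N / δ)
        = 4 * Real.log (N / δ) + 4 * (2 / c₀ * Real.log (N / δ)) := by ring
    linarith
  have h2 : Real.exp (-2) ≤ 1 / 6 := by
    have h3 := Real.exp_neg_one_lt_d9
    have : Real.exp (-2) = Real.exp (-1) * Real.exp (-1) := by rw [← Real.exp_add]; norm_num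
    rw [this]
    nlinarith [Real.exp_pos (-1)]
  calc N * Real.exp (-(x / 4)) ≤ N * Real.exp (-Real.log (N / δ) - 2) := by gcongr
    _ = δ * Real.exp (-2) := by
        rw [sub_eq_add_neg, Real.exp_add, Real.exp_neg, Real.exp_log (by positivity)]
        field_simp
    _ ≤ δ * (1 / 6) := by gcongr
    _ = δ / 6 := by ring

/-- A constant that beats its own logarithm. -/
theorem exists_large_constant {c₀ : ℝ} (hc₀ : 0 < c₀) :
    ∃ B : ℝ, 1 ≤ B ∧ 1 ≤ B * c₀ ∧ (Real.log B + 15) / c₀ + 2 ≤ B / 18 := by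
  set K : ℝ := 306 * (1 + 1 / c₀) with hK
  have hK1 : 306 ≤ K := by
    rw [hK]; have : 0 < 1 / c₀ := by positivity
    linarith
  have hKc : K * c₀ = 306 * (c₀ + 1) := by rw [hK]; field_simp
  -- The witness is a square so that its logarithm is at most `2 * K`, while `K ^ 2 * c₀ / 18`
  -- equals `17 * K * (c₀ + 1)`.
  refine ⟨K ^ 2, by nlinarith, by nlinarith, ?_⟩
  · have hlog : Real.log (K ^ 2) ≤ 2 * K := by
      rw [Real.log_pow]
      push_cast
      linarith [Real.log_le_self (show 0 ≤ K by linarith)]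
    rw [div_add' _ _ _ hc₀.ne', div_le_iff₀ hc₀]
    have : K ^ 2 / 18 * c₀ = 17 * K * (c₀ + 1) := by
      rw [show K ^ 2 / 18 * c₀ = K * (K * c₀) / 18 by ring, hKc]; ring
    rw [this]
    nlinarith

/-- The sample size of Step 3 suffices for all `n` workers together. -/
theorem sample_size_bound {c₀ B ε δ Δ s n : ℝ} {m d : ℕ} (hc₀ : 0 < c₀) (hB : 1 ≤ B)
    (hBlog : (Real.log B + 15) / c₀ + 2 ≤ B / 18)
    (hδ : 0 < δ) (hδc : c₀ ≤ Real.log (1 / δ)) (hd : 1 ≤ d) (hn : 1 ≤ n) (hε0 : 0 < ε)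
    (hΔ0 : 0 < Δ) (hs : 1 ≤ s) (hsn : Real.log n ≤ s)
    (hsε : Real.log (1 / ε) ≤ s) (hsΔ : Real.log (1 / Δ) ≤ 2 + s)
    (hm : B * d * Real.log (1 / δ) * s / (ε * Δ ^ 2) ≤ m)
    (hm2 : m ≤ 2 * (B * d * Real.log (1 / δ) * s / (ε * Δ ^ 2))) :
    n * (3 * (Real.exp 1 * (2 * m) / d) ^ d * Real.exp (-(m * ε * Δ ^ 2 / 18))) ≤ δ / 3 := by
  set l := Real.log (1 / δ) with hl
  have hd0 : (1 : ℝ) ≤ d := by exact_mod_cast hd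
  have hl0 : 0 < l := by linarith
  have hx0 : 0 < B * d * l * s / (ε * Δ ^ 2) := by positivity
  have hm0 : (0 : ℝ) < m := by linarith
  have hy : Real.exp 1 * (2 * m) / d ≤ 4 * Real.exp 1 * B * l * s / (ε * Δ ^ 2) := by
    rw [div_le_iff₀ (by linarith)]
    calc Real.exp 1 * (2 * m)
        ≤ Real.exp 1 * (2 * (2 * (B * d * l * s / (ε * Δ ^ 2)))) := by gcongr
      _ = _ := by ring
  have hlogy : Real.log (Real.exp 1 * (2 * m) / d) ≤ Real.log B + 7 + l + 4 * s := by
    refine (Real.log_le_log (by positivity) hy).trans ?_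
    -- One logarithm per factor: `4`, `exp 1` and `(1 / Δ) ^ 2` supply the additive constants, and
    -- `s`, `1 / ε` and `(1 / Δ) ^ 2` supply the multiples of `s`.
    have e : 4 * Real.exp 1 * B * l * s / (ε * Δ ^ 2)
        = 4 * (Real.exp 1 * (B * (l * (s * ((1 / ε) * (1 / Δ) ^ 2))))) := by
      field_simp
    rw [e, Real.log_mul (by norm_num) (by positivity), Real.log_mul (by positivity) (by positivity),
      Real.log_mul (by positivity) (by positivity), Real.log_mul (by positivity) (by positivity),
      Real.log_mul (by positivity) (by positivity), Real.log_mul (by positivity) (by positivity),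
      Real.log_pow, Real.log_exp]
    have h4 : Real.log 4 ≤ 2 := by
      rw [show (4 : ℝ) = 2 ^ 2 by norm_num, Real.log_pow]
      have := Real.log_two_lt_d9
      push_cast; linarith
    have h5 : Real.log l ≤ l := Real.log_le_self hl0.le
    have h6 : Real.log s ≤ s - 1 := Real.log_le_sub_one_of_pos (by linarith)
    push_cast
    linarith
  have hexp : Real.log (9 * n / δ) + d * Real.log (Real.exp 1 * (2 * m) / d)
      ≤ m * ε * Δ ^ 2 / 18 := by
    have h1 : B * d * l * s ≤ m * (ε * Δ ^ 2) := by
      rwa [div_le_iff₀ (by positivity)] at hm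
    have h2 : Real.log (9 * n / δ) ≤ 3 + s + l := by
      rw [show 9 * n / δ = 9 * (n * (1 / δ)) by ring, Real.log_mul (by norm_num) (by positivity),
        Real.log_mul (by positivity) (by positivity)]
      have : Real.log 9 ≤ 3 := by
        calc Real.log 9 ≤ Real.log ((2 : ℝ) ^ 4) := Real.log_le_log (by norm_num) (by norm_num)
          _ ≤ 3 := by
            rw [Real.log_pow]; have := Real.log_two_lt_d9
            push_cast; linarith
      linarith
    -- The defining inequality of `B` is used here: `s ≥ 1` merges the constants into `(log B + 15)
    -- * s`, and `l ≥ c₀` bounds `s` by `l * s / c₀`.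
    have h3 : Real.log B + 10 + 2 * l + 5 * s ≤ B / 18 * (l * s) := by
      have hB0 : 0 ≤ Real.log B := Real.log_nonneg hB
      have h4 : s ≤ l * s / c₀ := by rw [le_div_iff₀ hc₀]; nlinarith
      have h5 : 2 * l ≤ 2 * (l * s) := by nlinarith
      have h6 := mul_le_mul_of_nonneg_right hBlog (show 0 ≤ l * s by positivity)
      have h7 : (Real.log B + 15) * s ≤ (Real.log B + 15) * (l * s / c₀) :=
        mul_le_mul_of_nonneg_left h4 (by linarith)
      have h8 : ((Real.log B + 15) / c₀ + 2) * (l * s)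
          = (Real.log B + 15) * (l * s / c₀) + 2 * (l * s) := by ring
      nlinarith
    have h4 := mul_le_mul_of_nonneg_left h3 (show (0 : ℝ) ≤ d by linarith)
    have h5 := mul_le_mul_of_nonneg_left hlogy (show (0 : ℝ) ≤ d by linarith)
    have h6 : 3 + s + l ≤ d * (3 + s + l) := le_mul_of_one_le_left (by linarith) hd0
    have h7 : d * (B / 18 * (l * s)) = B * d * l * s / 18 := by ring
    have h8 : m * ε * Δ ^ 2 = m * (ε * Δ ^ 2) := by ring
    linarith
  set Y := Real.exp 1 * (2 * m) / d with hY
  have hY0 : 0 < Y := by positivity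
  have e : n * (3 * Y ^ d * Real.exp (-(m * ε * Δ ^ 2 / 18)))
      = δ / 3 * Real.exp (Real.log (9 * n / δ) + d * Real.log Y - m * ε * Δ ^ 2 / 18) := by
    rw [sub_eq_add_neg, Real.exp_add, Real.exp_add, Real.exp_log (by positivity), Real.exp_nat_mul,
      Real.exp_log hY0]
    field_simp
    ring
  rw [e]
  exact mul_le_of_le_one_right (by positivity) (Real.exp_le_one_iff.2 (by linarith))

/-- The tasks of all three steps, up to constants. -/
theorem total_cost_le {c₀ A B ε δ a b s n : ℝ} {T L m d : ℕ} (hc₀ : 0 < c₀) (hA : 1 ≤ A)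
    (hAc : 1 ≤ A * c₀) (hB : 0 ≤ B) (hδ : 0 < δ) (hδc : c₀ ≤ Real.log (1 / δ)) (hn : 1 ≤ n)
    (hε : 0 < ε) (ha0 : 0 < a) (ha1 : a ≤ 1) (hb0 : 0 < b) (hb1 : b ≤ 1) (hs : 1 ≤ s)
    (hsn : Real.log n ≤ s) (hsb : Real.log (1 / b) ≤ s) (hT1 : 1 ≤ T)
    (hT : (T : ℝ) ≤ A * Real.log (n / δ) / (b / 4) ^ 2 + 1)
    (hL : (L : ℝ) ≤ A * Real.log (T / δ) / a ^ 2 + 1)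
    (hm : m ≤ 2 * (B * d * Real.log (1 / δ) * s / (ε * (b / 4) ^ 2))) :
    (T * L + n * T + m : ℝ)
      ≤ (64 * A ^ 2 * (32 * A / c₀ + 2 / c₀ + 2) + 32 * A * (1 / c₀ + 1) + 32 * B)
        * (Real.log (n / δ) ^ 2 / (b ^ 2 * a ^ 2)
          + (n + d / ε) * Real.log (1 / δ) / b ^ 2) * s := by
  set l := Real.log (1 / δ) with hl
  set r := Real.log (n / δ) with hr
  have hl0 : 0 < l := by linarith
  have hrl : r = Real.log n + l := by
    rw [hr, hl, div_eq_mul_one_div, Real.log_mul (by positivity) (by positivity)]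
  have hlogn : 0 ≤ Real.log n := Real.log_nonneg hn
  have hr0 : c₀ ≤ r := by linarith
  have hrpos : 0 < r := by linarith
  have hT1' : (1 : ℝ) ≤ T := by exact_mod_cast hT1
  have hb2 : b ^ 2 ≤ 1 := pow_le_one₀ hb0.le hb1
  have ha2 : a ^ 2 ≤ 1 := pow_le_one₀ ha0.le ha1
  have hTle : (T : ℝ) ≤ 32 * A * r / b ^ 2 := by
    have h1 : A * r / (b / 4) ^ 2 = 16 * (A * r) / b ^ 2 := by field_simp; ring
    have h2 : 1 ≤ 16 * (A * r) / b ^ 2 := by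
      rw [le_div_iff₀ (by positivity)]; nlinarith
    rw [h1] at hT
    calc (T : ℝ) ≤ 16 * (A * r) / b ^ 2 + 16 * (A * r) / b ^ 2 := by linarith
      _ = _ := by ring
  -- Besides a power of `1 / b`, `T` involves only `r` and constants, so `log (T / δ)` is `r` up to
  -- one factor `s`. Hence `T * L` has `r ^ 2` in the numerator and a single suppressed logarithm.
  have hTδ : Real.log (T / δ) ≤ r * s * (32 * A / c₀ + 2 / c₀ + 2) := by
    have h1 : Real.log (T / δ) = Real.log T + l := by
      rw [hl, div_eq_mul_one_div, Real.log_mul (by positivity) (by positivity)]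
    have h2 : Real.log T ≤ 32 * A + r + 2 * s := by
      refine (Real.log_le_log (by linarith) hTle).trans ?_
      rw [show 32 * A * r / b ^ 2 = 32 * A * (r * (1 / b) ^ 2) by field_simp,
        Real.log_mul (x := 32 * A) (by positivity) (by positivity),
        Real.log_mul (x := r) (by positivity) (by positivity), Real.log_pow]
      have h3 := Real.log_le_self (show 0 ≤ 32 * A by linarith)
      have h4 := Real.log_le_self hrpos.le
      push_cast
      linarith
    have h3 : 1 ≤ r / c₀ := by rwa [le_div_iff₀ hc₀, one_mul]
    have h4 : s ≤ r / c₀ * s := le_mul_of_one_le_left (by linarith) h3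
    have h5 : 32 * A ≤ 32 * A * (r / c₀ * s) :=
      le_mul_of_one_le_right (by linarith) (by linarith)
    have h6 : r ≤ r * s := le_mul_of_one_le_right hrpos.le hs
    calc Real.log (T / δ) ≤ 32 * A * (r / c₀ * s) + 2 * (r / c₀ * s) + 2 * (r * s) := by linarith
      _ = _ := by ring
  have hTδ0 : c₀ ≤ Real.log (T / δ) := hδc.trans (Real.log_le_log (by positivity) (by gcongr))
  have hLle : (L : ℝ) ≤ 2 * A * Real.log (T / δ) / a ^ 2 := by
    have h2 : 1 ≤ A * Real.log (T / δ) / a ^ 2 := by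
      rw [le_div_iff₀ (by positivity)]; nlinarith
    calc (L : ℝ) ≤ A * Real.log (T / δ) / a ^ 2 + A * Real.log (T / δ) / a ^ 2 := by linarith
      _ = _ := by ring
  have hTL : (T * L : ℝ) ≤ 64 * A ^ 2 * (32 * A / c₀ + 2 / c₀ + 2)
      * (r ^ 2 / (b ^ 2 * a ^ 2) * s) := by
    calc (T * L : ℝ) ≤ (32 * A * r / b ^ 2)
          * (2 * A * (r * s * (32 * A / c₀ + 2 / c₀ + 2)) / a ^ 2) := by
          refine mul_le_mul hTle (hLle.trans ?_) (Nat.cast_nonneg _) (by positivity)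
          gcongr
      _ = _ := by field_simp; ring
  -- The term `n * T` is to carry `log (1 / δ)` rather than `log (n / δ)`; the surplus `log n` is
  -- moved into the suppressed factor `s`.
  have hrle : r ≤ l * s * (1 / c₀ + 1) := by
    have h3 : 1 ≤ l / c₀ := by rwa [le_div_iff₀ hc₀, one_mul]
    have h4 : s ≤ l / c₀ * s := le_mul_of_one_le_left (by linarith) h3
    have h6 : l ≤ l * s := le_mul_of_one_le_right hl0.le hs
    calc r ≤ l / c₀ * s + l * s := by linarith
      _ = _ := by ring
  have hnT : n * T ≤ 32 * A * (1 / c₀ + 1) * (n * l / b ^ 2 * s) := by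
    calc n * T ≤ n * (32 * A * (l * s * (1 / c₀ + 1)) / b ^ 2) := by
          refine mul_le_mul_of_nonneg_left (hTle.trans ?_) (by linarith)
          gcongr
      _ = _ := by ring
  have hmle : (m : ℝ) ≤ 32 * B * (d / ε * l / b ^ 2 * s) := by
    refine hm.trans (le_of_eq ?_)
    field_simp
    ring
  have hsum : (r ^ 2 / (b ^ 2 * a ^ 2) + (n + d / ε) * l / b ^ 2) * s
      = r ^ 2 / (b ^ 2 * a ^ 2) * s + n * l / b ^ 2 * s + d / ε * l / b ^ 2 * s := by ring
  rw [mul_assoc, hsum]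
  generalize hu' : r ^ 2 / (b ^ 2 * a ^ 2) * s = u at *
  generalize hv' : n * l / b ^ 2 * s = v at *
  generalize hw' : d / ε * l / b ^ 2 * s = w at *
  have hu : 0 ≤ u := by rw [← hu']; positivity
  have hv : 0 ≤ v := by rw [← hv']; positivity
  have hw : 0 ≤ w := by rw [← hw']; positivity
  have hk₁ : 0 ≤ 64 * A ^ 2 * (32 * A / c₀ + 2 / c₀ + 2) := by positivity
  have hk₂ : 0 ≤ 32 * A * (1 / c₀ + 1) := by positivity
  generalize 64 * A ^ 2 * (32 * A / c₀ + 2 / c₀ + 2) = k₁ at hTL hk₁ ⊢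
  generalize 32 * A * (1 / c₀ + 1) = k₂ at hnT hk₂ ⊢
  have e : (k₁ + k₂ + 32 * B) * (u + v + w) = k₁ * u + k₂ * v + 32 * B * w
      + (k₁ * (v + w) + k₂ * (u + w) + 32 * B * (u + v)) := by ring
  have h0 : 0 ≤ k₁ * (v + w) + k₂ * (u + w) + 32 * B * (u + v) := by positivity
  linarith

/-! ### Elementary bounds on noise rates, the suppressed logarithm and the training size -/

theorem avgRate_nonneg {n : ℕ} (η : Fin n → unitInterval) : 0 ≤ avgRate η :=
  div_nonneg (Finset.sum_nonneg fun w _ => (η w).2.1) (Nat.cast_nonneg n)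

section

variable {n : ℕ} [NeZero n] (η : Fin n → unitInterval)

theorem bestRate_nonneg : 0 ≤ bestRate η := le_ciInf fun w => (η w).2.1

theorem bestRate_le_avgRate : bestRate η ≤ avgRate η := by
  have hn : (0 : ℝ) < n := by exact_mod_cast NeZero.pos n
  rw [avgRate, le_div_iff₀ hn]
  calc bestRate η * n = ∑ _w : Fin n, bestRate η := by simp [mul_comm]
    _ ≤ ∑ w, (η w : ℝ) :=
      Finset.sum_le_sum fun w _ => ciInf_le (Set.finite_range _).bddBelow w

end

section

variable {n : ℕ} [NeZero n] (η : Fin n → unitInterval)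

theorem one_le_natCast_of_neZero (n : ℕ) [NeZero n] : (1 : ℝ) ≤ n := by
  exact_mod_cast NeZero.one_le

variable {η} in
theorem log_le_softLog {ε y : ℝ} (hε : 0 < ε) (hb : 0 < 1 - 2 * bestRate η) (hy : 0 < y)
    (h : y ≤ n ∨ y ≤ 1 / ε ∨ y ≤ 1 / (1 - 2 * bestRate η)) : Real.log y ≤ softLog η ε := by
  have h1 : 0 < 1 / ε := by positivity
  have h2 : 0 < 1 / (1 - 2 * bestRate η) := by positivity
  have h3 := one_le_natCast_of_neZero n
  refine Real.log_le_log hy ?_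
  rcases h with h | h | h <;> linarith

variable {η} in
theorem one_le_softLog {ε : ℝ} (hε : 0 < ε) (hb : 0 < 1 - 2 * bestRate η) :
    1 ≤ softLog η ε := by
  have h1 : 0 < 1 / ε := by positivity
  have h2 : 0 < 1 / (1 - 2 * bestRate η) := by positivity
  have h3 := one_le_natCast_of_neZero n
  rw [softLog, Real.le_log_iff_exp_le (by positivity)]
  linarith [Real.exp_one_lt_d9]

end

theorem one_le_ceil_and_ceil_le {x : ℝ} (hx : 0 < x) :
    1 ≤ ⌈x⌉₊ ∧ (⌈x⌉₊ : ℝ) ≤ x + 1 :=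
  ⟨Nat.one_le_ceil_iff.2 hx, (Nat.ceil_lt_add_one hx.le).le⟩

/-- The sample size of Step 3, with the constant `B`; no sample is needed if the class is trivial or
the accuracy is. -/
noncomputable def trainingSize {n : ℕ} (B : ℝ) (η : Fin n → unitInterval) (d : ℕ) (ε δ : ℝ) : ℕ :=
  if d = 0 ∨ 1 < ε then 0
  else ⌈B * d * Real.log (1 / δ) * softLog η ε / (ε * gap η ^ 2)⌉₊

/-- Since `gap η ≤ 1 / 4`, the denominator gains a factor 16. In the nontrivial case this makes the
sample size at least `d`, as Sauer-Shelah needs, and `m * ε` at least 12, as the ghost sample needs.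
-/
theorem sixteen_mul_le_trainingSize {n : ℕ} [NeZero n] {η : Fin n → unitInterval}
    {c₀ B ε δ : ℝ} (d : ℕ) (hbest : bestRate η < 1 / 2) (hB : 1 ≤ B) (hBc : 1 ≤ B * c₀)
    (hε : 0 < ε) (hδc : c₀ ≤ Real.log (1 / δ)) :
    16 * d / ε ≤ B * d * Real.log (1 / δ) * softLog η ε / (ε * gap η ^ 2) := by
  have hs := one_le_softLog hε (show 0 < 1 - 2 * bestRate η by linarith)
  have hΔ : gap η = (1 - 2 * bestRate η) / 4 := by rw [gap]; ring
  have hΔ0 : 0 < gap η := by rw [hΔ]; linarith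
  have hΔ1 : gap η ≤ 1 / 4 := by rw [hΔ]; linarith [bestRate_nonneg η]
  have h1 : gap η ^ 2 ≤ 1 / 16 := by nlinarith
  have h2 : 1 ≤ B * Real.log (1 / δ) * softLog η ε := by
    have h3 : B * c₀ ≤ B * Real.log (1 / δ) := by gcongr
    nlinarith
  calc 16 * d / ε = d * 1 / (ε * (1 / 16)) := by field_simp
    _ ≤ d * (B * Real.log (1 / δ) * softLog η ε) / (ε * gap η ^ 2) := by gcongr
    _ = _ := by ring

/-- The argument of the ceiling is at least 1 in the nontrivial case, so rounding up at most doubles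
it. -/
theorem trainingSize_le {n : ℕ} [NeZero n] {η : Fin n → unitInterval} {c₀ B ε δ : ℝ} {d : ℕ}
    (hbest : bestRate η < 1 / 2) (hB : 1 ≤ B) (hBc : 1 ≤ B * c₀)
    (hε : 0 < ε) (hδc : c₀ ≤ Real.log (1 / δ)) :
    (trainingSize B η d ε δ : ℝ)
      ≤ 2 * (B * d * Real.log (1 / δ) * softLog η ε / (ε * gap η ^ 2)) := by
  have h := sixteen_mul_le_trainingSize d hbest hB hBc hε hδc
  have h0 : 0 ≤ 16 * d / ε := by positivity
  unfold trainingSize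
  split_ifs with htriv
  · simp only [Nat.cast_zero]; linarith
  · obtain ⟨hd, hε1⟩ := not_or.1 htriv
    have hd1 : (1 : ℝ) ≤ d := by exact_mod_cast Nat.one_le_iff_ne_zero.2 hd
    have h1 : 1 ≤ 16 * d / ε := by rw [le_div_iff₀ hε]; linarith
    have := (one_le_ceil_and_ceil_le (lt_of_lt_of_le one_pos (h1.trans h))).2
    linarith

/-- With the chosen sample size, all nearly optimal workers supply good enough labels. -/
theorem training_failure_le {n : ℕ} [NeZero n] {η : Fin n → unitInterval} {c₀ B ε δ : ℝ} {d : ℕ}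
    (hη : ∀ w, (η w : ℝ) ≤ 1 / 2) (hbest : bestRate η < 1 / 2)
    (hc₀ : 0 < c₀) (hB : 1 ≤ B) (hBc : 1 ≤ B * c₀)
    (hBlog : (Real.log B + 15) / c₀ + 2 ≤ B / 18)
    (hε : 0 < ε) (hδ : 0 < δ) (hδc : c₀ ≤ Real.log (1 / δ))
    {X : Type*} [MeasurableSpace X] {𝒞 : Set (X → Bool)} (hmeas : ∀ h ∈ 𝒞, Measurable h)
    (hsep : UniversallySeparable 𝒞) (hd : vcDimension 𝒞 = d) {c : X → Bool} (hc : c ∈ 𝒞)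
    (D : Measure X) [IsProbabilityMeasure D] (w : Fin n) (hw : IsOptimalWorker η (gap η) w) :
    (Measure.pi fun _ : Fin (trainingSize B η d ε δ) =>
        D.prod (bernoulliMeasure true false (η w)))
      {s | ∃ h ∈ 𝒞, ε ≤ D.real {x | h x ≠ c x} ∧ Misleading s {x | h x ≠ c x}}
      ≤ ENNReal.ofReal (δ / 3 / n) := by
  by_cases htriv : d = 0 ∨ 1 < ε
  · have hempty : {s : Fin (trainingSize B η d ε δ) → X × Bool | ∃ h ∈ 𝒞,
        ε ≤ D.real {x | h x ≠ c x} ∧ Misleading s {x | h x ≠ c x}} = ∅ := by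
      refine Set.eq_empty_iff_forall_notMem.2 ?_
      rintro s ⟨h, hh, hD, -⟩
      rcases htriv with rfl | h1
      · rw [eq_of_vcDimension_eq_zero (by simpa using hd) hh hc] at hD
        simp at hD
        linarith
      · have : D.real {x | h x ≠ c x} ≤ 1 := measureReal_le_one
        linarith
    rw [hempty]
    simp
  obtain ⟨hd0, hε1⟩ := not_or.1 htriv
  have hd1 : 1 ≤ d := Nat.one_le_iff_ne_zero.2 hd0
  rw [not_lt] at hε1
  have hd1' : (1 : ℝ) ≤ d := by exact_mod_cast hd1
  have hb : 0 < 1 - 2 * bestRate η := by linarith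
  have hn := one_le_natCast_of_neZero n
  have hs := one_le_softLog hε hb
  have hΔ : gap η = (1 - 2 * bestRate η) / 4 := by rw [gap]; ring
  have hΔ0 : 0 < gap η := by rw [hΔ]; linarith
  have hl0 : 0 < Real.log (1 / δ) := by linarith
  set x := B * d * Real.log (1 / δ) * softLog η ε / (ε * gap η ^ 2) with hx
  have hxd : 16 * d / ε ≤ x := sixteen_mul_le_trainingSize d hbest hB hBc hε hδc
  have hdε : (d : ℝ) ≤ d / ε := by rw [le_div_iff₀ hε]; nlinarith
  have h16 : 16 * d / ε = 16 * (d / ε) := by ring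
  have hm : trainingSize B η d ε δ = ⌈x⌉₊ := by rw [trainingSize, if_neg htriv]
  rw [hm]
  set m := ⌈x⌉₊
  have hxm : x ≤ m := Nat.le_ceil x
  have hm2 : (m : ℝ) ≤ 2 * x := hm ▸ trainingSize_le hbest hB hBc hε hδc
  have hdm : d ≤ m := by
    have : (d : ℝ) ≤ m := by linarith
    exact_mod_cast this
  have hmε : 12 ≤ m * ε := by
    have h1 : 16 * d / ε ≤ m := hxd.trans hxm
    rw [div_le_iff₀ hε] at h1
    linarith
  -- The best worker has margin `4 * gap η`, and an optimal one loses at most `2 * gap η` of it.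
  -- Hence the exponent `1 / 72` becomes `1 / 18` in terms of `gap η`.
  have hγ : (2 * gap η) ^ 2 ≤ (1 - 2 * (η w : ℝ)) ^ 2 := by
    refine pow_le_pow_left₀ (by linarith) ?_ 2
    have h1 : (η w : ℝ) ≤ bestRate η + gap η := hw
    rw [hΔ] at h1 ⊢
    linarith
  refine (vc_misleading_le D (η w) (hη w) hmeas hsep hd hd1 hdm hc hmε).trans
    (ENNReal.ofReal_le_ofReal ?_)
  rw [le_div_iff₀ (by linarith), mul_comm]
  refine le_trans ?_ (sample_size_bound (n := n) hc₀ hB hBlog hδ hδc hd1 hn hε hΔ0 hs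
    (log_le_softLog hε hb (by linarith) (Or.inl le_rfl))
    (log_le_softLog hε hb (by positivity) (Or.inr (Or.inl le_rfl))) ?_ hxm hm2)
  · refine mul_le_mul_of_nonneg_left ?_ (by linarith)
    refine mul_le_mul_of_nonneg_left (Real.exp_le_exp.2 (neg_le_neg ?_)) (by positivity)
    have := mul_le_mul_of_nonneg_left hγ (show 0 ≤ m * ε by linarith)
    linarith
  · rw [hΔ, one_div_div, div_eq_mul_one_div, Real.log_mul (by norm_num) (by positivity)]
    have h1 := log_le_softLog hε hb (y := 1 / (1 - 2 * bestRate η)) (by positivity)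
      (Or.inr (Or.inr le_rfl))
    have h4 : Real.log 4 ≤ 2 := by
      rw [show (4 : ℝ) = 2 ^ 2 by norm_num, Real.log_pow]
      have := Real.log_two_lt_d9
      push_cast; linarith
    linarith

/-! ### Assembly of the theorem -/

theorem theorem5 (δ₀ : ℝ) (hδ₀ : δ₀ < 1) :
    ∃ (A C : ℝ) (k : ℕ), 0 < A ∧ 0 < C ∧
      ∀ (n : ℕ) [NeZero n] (η : Fin n → unitInterval) (d : ℕ) (ε δ : ℝ),
        (∀ w, (η w : ℝ) ≤ 1 / 2) → avgRate η < 1 / 2 →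
        0 < ε → 0 < δ → δ ≤ δ₀ →
        votesPerPoint A η δ ≤ n →
        ∃ m : ℕ, ∀ (X : Type*) [MeasurableSpace X] (𝒞 : Set (X → Bool)),
          (∀ h ∈ 𝒞, Measurable h) → UniversallySeparable 𝒞 → vcDimension 𝒞 = d →
          ∀ erm : List (X × Bool) → X → Bool, IsERM 𝒞 erm →
          ∀ c ∈ 𝒞, ∀ (D : Measure X) [IsProbabilityMeasure D],
            (∀ ω : Outcome X n (truthSize A η δ) (votesPerPoint A η δ) m,
              ((crowdRun c erm ω).tasks : ℝ) ≤ C * taskBound η d ε δ * softLog η ε ^ k ∧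
              ((crowdRun c erm ω).steps : ℝ) ≤ C * taskBound η d ε δ * softLog η ε ^ k) ∧
            outcomeLaw D η (truthSize A η δ) (votesPerPoint A η δ) m
                {ω | ¬ (IsOptimalWorker η (gap η) (crowdRun c erm ω).val.1 ∧
                  D.real {x | (crowdRun c erm ω).val.2 x ≠ c x} < ε)} ≤ ENNReal.ofReal δ := by
  -- The maximum keeps `δ₁` positive even for `δ₀ ≤ 0`; `c₀ = log (1 / δ₁)` is then a positive lower
  -- bound for `log (1 / δ)`, and all constants are built from it.
  set δ₁ := max δ₀ (1 / 2) with hδ₁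
  have hδ₁0 : 0 < δ₁ := lt_of_lt_of_le (by norm_num) (le_max_right _ _)
  have hδ₁1 : δ₁ < 1 := max_lt hδ₀ (by norm_num)
  set c₀ := Real.log (1 / δ₁) with hc₀def
  have hc₀ : 0 < c₀ := Real.log_pos (by rw [lt_div_iff₀ hδ₁0]; linarith)
  obtain ⟨B, hB, hBc, hBlog⟩ := exists_large_constant hc₀
  set A := 4 + 8 / c₀ with hA
  have hA1 : 1 ≤ A := by
    have : 0 < 8 / c₀ := by positivity
    linarith
  have hAc : 1 ≤ A * c₀ := by
    have : A * c₀ = 4 * c₀ + 8 := by rw [hA]; field_simp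
    linarith
  set C₁ := 64 * A ^ 2 * (32 * A / c₀ + 2 / c₀ + 2) + 32 * A * (1 / c₀ + 1) + 32 * B with hC₁
  have hC₁0 : 0 < C₁ := by positivity
  -- One power of the logarithm suffices. The factor 4 pays for the elementary steps, of which there
  -- are at most four times as many as tasks.
  refine ⟨A, 4 * C₁, 1, by linarith, by positivity, ?_⟩
  intro n _ η d ε δ hη havg hε hδ hδδ₀ hL
  have hδc : c₀ ≤ Real.log (1 / δ) :=
    Real.log_le_log (by positivity) (one_div_le_one_div_of_le hδ (hδδ₀.trans (le_max_left _ _)))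
  have hn := one_le_natCast_of_neZero n
  have hbest : bestRate η < 1 / 2 := (bestRate_le_avgRate η).trans_lt havg
  have hb0 : 0 < 1 - 2 * bestRate η := by linarith
  have hb1 : 1 - 2 * bestRate η ≤ 1 := by linarith [bestRate_nonneg η]
  have ha0 : 0 < 1 - 2 * avgRate η := by linarith
  have ha1 : 1 - 2 * avgRate η ≤ 1 := by linarith [avgRate_nonneg η]
  have hs := one_le_softLog hε hb0
  have hΔ : gap η = (1 - 2 * bestRate η) / 4 := by rw [gap]; ring
  have hΔ0 : 0 < gap η := by rw [hΔ]; linarith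
  have hΔ1 : gap η ≤ 1 := by rw [hΔ]; linarith
  set T := truthSize A η δ with hTdef
  set L := votesPerPoint A η δ with hLdef
  set m := trainingSize B η d ε δ with hmdef
  have hlogn : c₀ ≤ Real.log (n / δ) :=
    hδc.trans (Real.log_le_log (by positivity) (by gcongr))
  have hTx : 0 < A * Real.log (n / δ) / gap η ^ 2 := by
    have : 0 < Real.log (n / δ) := by linarith
    positivity
  obtain ⟨hT1, hT⟩ := one_le_ceil_and_ceil_le hTx
  have hT1' : (1 : ℝ) ≤ T := by exact_mod_cast hT1
  have hlogT : c₀ ≤ Real.log (T / δ) :=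
    hδc.trans (Real.log_le_log (by positivity) (by gcongr))
  have hLx : 0 < A * Real.log (T / δ) / (1 - 2 * avgRate η) ^ 2 := by
    have : 0 < Real.log (T / δ) := by linarith
    positivity
  obtain ⟨hL1, hL'⟩ := one_le_ceil_and_ceil_le hLx
  have hL1' : 1 ≤ L := hL1
  refine ⟨m, fun X _ 𝒞 hmeas hsep hd erm herm c hc D _ => ⟨fun ω => ?_, ?_⟩⟩
  · have hm := trainingSize_le (d := d) hbest hB hBc hε hδc
    rw [hΔ] at hm hT
    have hcost := total_cost_le (T := T) (L := L) (m := m) (n := n) hc₀ hA1 hAc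
      (by linarith : 0 ≤ B) hδ hδc hn hε ha0 ha1 hb0 hb1 hs
      (log_le_softLog hε hb0 (by linarith) (Or.inl le_rfl))
      (log_le_softLog hε hb0 (by positivity) (Or.inr (Or.inr le_rfl))) hT1
      (by simpa only [hTdef, truthSize, hΔ] using hT) hL' hm
    have hsteps : (crowdRun c erm ω).steps ≤ 4 * (T * L + n * T + m) := by
      rw [crowdRun_steps]
      have h1 : T ≤ T * L := Nat.le_mul_of_pos_right _ hL1'
      have h2 : n ≤ n * T := Nat.le_mul_of_pos_right _ hT1
      have h3 : 1 ≤ T := hT1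
      have e : T * (2 * L + 1) + n * (3 * T + 1) + (2 * m + 1)
          = 2 * (T * L) + T + 3 * (n * T) + n + 2 * m + 1 := by ring
      omega
    have htasks : (crowdRun c erm ω).tasks ≤ 4 * (T * L + n * T + m) := by
      rw [crowdRun_tasks]; omega
    have hbound : ((4 * (T * L + n * T + m) : ℕ) : ℝ)
        ≤ 4 * C₁ * taskBound η d ε δ * softLog η ε ^ 1 := by
      push_cast
      rw [pow_one, mul_assoc, mul_assoc, ← mul_assoc C₁]
      exact mul_le_mul_of_nonneg_left hcost (by norm_num)
    exact ⟨(Nat.cast_le.2 htasks).trans hbound, (Nat.cast_le.2 hsteps).trans hbound⟩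
  · have hfail := outcomeLaw_failure_le (T := T) (L := L) (m := m) D η hL hT1 havg.le hΔ0.le hΔ1
      herm hc (training_failure_le hη hbest hc₀ hB hBc hBlog hε hδ hδc hmeas hsep hd hc D)
    refine hfail.trans ?_
    -- The failure budget is `δ / 6` for the votes, `δ / 3` for the two-sided deviations and `δ / 3`
    -- for learning.
    have h1 : T * Real.exp (-(L * (1 - 2 * avgRate η) ^ 2 / 4)) ≤ δ / 6 := by
      refine mul_exp_neg_le hc₀ hT1' hδ hδc ?_
      have := Nat.le_ceil (A * Real.log (T / δ) / (1 - 2 * avgRate η) ^ 2)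
      rwa [div_le_iff₀ (by positivity)] at this
    have h2 : n * Real.exp (-(T * gap η ^ 2 / 4)) ≤ δ / 6 := by
      refine mul_exp_neg_le hc₀ hn hδ hδc ?_
      have := Nat.le_ceil (A * Real.log (n / δ) / gap η ^ 2)
      rwa [div_le_iff₀ (by positivity)] at this
    have e1 : (T : ℝ≥0∞) * ENNReal.ofReal (Real.exp (-(L * (1 - 2 * avgRate η) ^ 2 / 4)))
        ≤ ENNReal.ofReal (δ / 6) := by
      rw [← ENNReal.ofReal_natCast, ← ENNReal.ofReal_mul (Nat.cast_nonneg _)]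
      exact ENNReal.ofReal_le_ofReal h1
    have e2 : (n : ℝ≥0∞) * (2 * ENNReal.ofReal (Real.exp (-(T * gap η ^ 2 / 4))))
        ≤ ENNReal.ofReal (δ / 3) := by
      rw [← ENNReal.ofReal_natCast, ← ENNReal.ofReal_ofNat, ← ENNReal.ofReal_mul (by norm_num),
        ← ENNReal.ofReal_mul (Nat.cast_nonneg _)]
      exact ENNReal.ofReal_le_ofReal (by linarith)
    have e3 : (n : ℝ≥0∞) * ENNReal.ofReal (δ / 3 / n) = ENNReal.ofReal (δ / 3) := by
      rw [← ENNReal.ofReal_natCast, ← ENNReal.ofReal_mul (Nat.cast_nonneg _)]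
      congr 1
      field_simp
    rw [e3]
    refine (add_le_add (add_le_add e1 e2) le_rfl).trans ?_
    rw [← ENNReal.ofReal_add (by positivity) (by positivity),
      ← ENNReal.ofReal_add (by positivity) (by positivity)]
    exact ENNReal.ofReal_le_ofReal (by linarith)
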